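/- **Setting.** Let $G$ be a semisimple Lie group with a maximal compact subgroup $K$ and an Iwasawa decomposition $G=KAN$, written $g=k(g)a(g)n(g)$ ($A=\exp\mathfrak a$ with $\mathfrak a$ a maximal abelian subspace of the $(-1)$-eigenspace of the Cartan involution with fixed algebra $\mathrm{Lie}(K)$, $N$ the connected subgroup of the positive restricted root spaces $\mathfrak n$), $M=Z_K(A)$, $\rho(H)=\frac12\mathrm{Tr}(\mathrm{ad}\,H|_{\mathfrak n})$. Let $\Gamma\subset G$ be a discrete, torsion free, cocompact subgroup; $\Gamma\backslash G$ carries a nonzero finite $G$-invariant measure, $K$ the Haar measure of total mass one. Inner products are linear in the second variable. Let $(\kappa,V_\kappa)$ be an irreducible unitary representation of $M$ and $(\gamma,V_\gamma)$ a finite dimensional unitary representation of $K$. Let $T\in[V_\kappa\otimes V_\gamma]^M$ with $\|T\|=1$. For $\lambda\in\mathfrak a^*$ let $H^{\kappa,i\lambda}=L^2(K\times_MV_\kappa)$ be the space of $L^2$-functions $\phi:K\to V_\kappa$ with $\phi(km)=\kappa(m)^{-1}\phi(k)$, with the action $(\pi^{\kappa,i\lambda}(g)\phi)(k)=a(g^{-1}k)^{i\lambda-\rho}\phi(k(g^{-1}k))$.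 A unitary embedding $\xi:H^{\kappa,i\lambda}\to L^2(\Gamma\backslash G)$ is a $G$-equivariant linear isometry, $G$ acting on $L^2(\Gamma\backslash G)$ by right translations; we also write $\xi$ for $\xi\otimes 1_{V_\gamma}$. Let $A_\gamma=C(\Gamma\backslash G)\otimes\mathrm{End}(V_\gamma)$, with the $K$-action $(kf)(\Gamma g)=\gamma(k)f(\Gamma gk)\gamma(k)^{-1}$; let $A_{\gamma,K}$ and $A_\gamma^K$ be the subalgebras of $K$-finite and of $K$-invariant elements. Put $\sigma_u(f)=\int_{\Gamma\backslash G}\langle u,fu\rangle$ for $u\in L^2(\Gamma\backslash G)\otimes V_\gamma$ and $\sigma^\xi_{\phi,\psi}(f)=\int_{\Gamma\backslash G}\langle\xi(\phi),f\,\xi(\psi)\rangle$. A point of $\mathfrak a^*$ is regular if no nontrivial element of the Weyl group $N_K(A)/M$ fixes it. Rays in $\mathfrak a^*$ are identified with unit vectors for the norm given by the Killing form. $L(\kappa)$ is the set of rays $l$ for which there are unitary embeddings $\xi_n:H^{\kappa,i\lambda_n}\to L^2(\Gamma\backslash G)$ with $\lambda_n\to\infty$ and $[\lambda_n]\to l$.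 For a regular $l\in L(\kappa)$, such a sequence is called $l$-conveniently arranged if moreover all $\lambda_n$ are regular and for all $\phi,\psi\in C^K(K\times_MV_\kappa)\otimes V_\gamma$ ($K$-finite sections) the functionals $\sigma^{\xi_n}_{\phi,\psi}$ on $A_\gamma$ converge weakly (pointwise); the limit is denoted $\sigma_{\phi,\psi}$. For a distribution $\delta$ with $\mu$-isotypic components $\delta_\mu$, $\mu\in\hat K$, put $\sigma_{\phi,\delta}(f)=\sum_{\mu\in\hat K}\sigma_{\phi,\delta_\mu}(f)$ for $f\in A_{\gamma,K}$ (a finite sum). Let $\psi_T(k)=(1\otimes\gamma(k))T$ be the $K$-invariant element of $C^\infty(K\times_MV_\kappa)\otimes V_\gamma$ with value $T$ at $1$, and let $\delta_T$ be the distribution $\phi\mapsto\langle T,\phi(1)\rangle$. The representation theoretic lift $\sigma_T$ associated to $(\xi_n)$ is the state on $A_\gamma$ which extends the functional $\sigma_{\psi_T,\delta_T}$ on $A_{\gamma,K}$. **Proposition.** Let $l\in L(\kappa)$ be regular and let $(\xi_n)$ be an $l$-conveniently arranged sequence of unitary embeddings. Then the functionals $\sigma_{\xi_n(\psi_T)}$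 are states on $A_\gamma^K$, and they converge weakly: for every $f\in A_\gamma^K$ the limit $\lim_n\sigma_{\xi_n(\psi_T)}(f)$ exists and equals $\sigma_{\psi_T,\delta_T}(f)$. In particular, if $\sigma_T$ is the representation theoretic lift associated to $(\xi_n)$, then $\lim_n\sigma_{\xi_n(\psi_T)}(f)=\sigma_T(f)$ for all $f\in A_\gamma^K$, i.e. the weak limit is the restriction of $\sigma_T$ to $A_\gamma^K$. -/

import Mathlib

open MeasureTheory Filter Topology
open scoped Manifold TensorProduct

noncomputable section

/-! ## Exponentials and Lie subalgebras -/

section Exponential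

variable {E : Type*} [NormedAddCommGroup E] [NormedSpace ℝ E]
  {G : Type*} [TopologicalSpace G] [ChartedSpace E G] [Group G]

/-- `c` is the one-parameter subgroup of `G` with velocity `X` at `0`, i.e. `c t = exp (t X)`. -/
def IsOneParam (c : ℝ → G) (X : GroupLieAlgebra 𝓘(ℝ, E) G) : Prop :=
  (∀ s t, c (s + t) = c s * c t) ∧
    HasMFDerivAt 𝓘(ℝ, ℝ) 𝓘(ℝ, E) c 0 (ContinuousLinearMap.toSpanSingleton ℝ (show E from X))

/-- The relation `g = exp X`. -/
def IsExp (X : GroupLieAlgebra 𝓘(ℝ, E) G) (g : G) : Prop :=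
  ∃ c : ℝ → G, IsOneParam c X ∧ c 1 = g

/-- The subgroup of `G` generated by `exp S`; for a Lie subalgebra `S` this is the connected
subgroup with Lie algebra `S`. -/
def expSubgroup (S : Set (GroupLieAlgebra 𝓘(ℝ, E) G)) : Subgroup G :=
  Subgroup.closure {g | ∃ X ∈ S, IsExp X g}

/-- `X` lies in the Lie algebra of the (closed) subgroup `H`: `exp (t X) ∈ H` for all `t`. -/
def InLieAlgebraOf (H : Subgroup G) (X : GroupLieAlgebra 𝓘(ℝ, E) G) : Prop :=
  ∃ c : ℝ → G, IsOneParam c X ∧ ∀ t, c t ∈ H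

/-- The adjoint action of `g` on the Lie algebra: the derivative at `1` of `x ↦ g x g⁻¹`. -/
def adjointAction (g : G) (X : GroupLieAlgebra 𝓘(ℝ, E) G) : GroupLieAlgebra 𝓘(ℝ, E) G :=
  (show E from mfderiv 𝓘(ℝ, E) 𝓘(ℝ, E) (fun x : G => g * x * g⁻¹) 1 X)

variable [CompleteSpace E] [LieGroup 𝓘(ℝ, E) (minSmoothness ℝ 3) G]

/-- `X` satisfies `[H, X] = α(H) X` for all `H ∈ 𝔞`. -/
def IsWeightVector (𝔞 : Submodule ℝ (GroupLieAlgebra 𝓘(ℝ, E) G)) (α : Module.Dual ℝ 𝔞)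
    (X : GroupLieAlgebra 𝓘(ℝ, E) G) : Prop :=
  ∀ H : 𝔞, ⁅(H : GroupLieAlgebra 𝓘(ℝ, E) G), X⁆ = α H • X

/-- The sum of the weight spaces of those `α` which are positive on `H₀`. -/
def positivePart (𝔞 : Submodule ℝ (GroupLieAlgebra 𝓘(ℝ, E) G)) (H₀ : 𝔞) :
    Submodule ℝ (GroupLieAlgebra 𝓘(ℝ, E) G) :=
  Submodule.span ℝ {X | ∃ α : Module.Dual ℝ 𝔞, 0 < α H₀ ∧ IsWeightVector 𝔞 α X}

theorem lie_mem_positivePart (𝔞 : Submodule ℝ (GroupLieAlgebra 𝓘(ℝ, E) G)) (H₀ H : 𝔞) :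
    ∀ X ∈ positivePart 𝔞 H₀,
      LieAlgebra.ad ℝ (GroupLieAlgebra 𝓘(ℝ, E) G) (H : GroupLieAlgebra 𝓘(ℝ, E) G) X ∈
        positivePart 𝔞 H₀ := by
  intro X hX
  induction hX using Submodule.span_induction with
  | mem X h =>
    obtain ⟨α, h0, hα⟩ := h
    rw [LieAlgebra.ad_apply, hα H]
    exact Submodule.smul_mem _ _ (Submodule.subset_span ⟨α, h0, hα⟩)
  | zero => rw [map_zero]; exact Submodule.zero_mem _
  | add X Y _ _ hX hY => rw [map_add]; exact Submodule.add_mem _ hX hY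
  | smul c X _ hX => rw [map_smul]; exact Submodule.smul_mem _ _ hX

end Exponential

/-! ## Iwasawa decompositions -/

/-- An Iwasawa decomposition `G = KAN` with respect to a maximal compact subgroup `K`.
Here `A = exp 𝔞`, and `N` is the connected subgroup with Lie algebra the sum of the positive
restricted root spaces, where positivity is determined by a regular element `H₀ ∈ 𝔞`. -/
structure IwasawaDecomposition (E : Type*) [NormedAddCommGroup E] [NormedSpace ℝ E]
    [CompleteSpace E] (G : Type*) [TopologicalSpace G] [ChartedSpace E G] [Group G]
    [LieGroup 𝓘(ℝ, E) (minSmoothness ℝ 3) G] where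
  /-- the maximal compact subgroup -/
  K : Subgroup G
  isCompact_K : IsCompact (K : Set G)
  maximal_K : ∀ K' : Subgroup G, IsCompact (K' : Set G) → K ≤ K' → K' = K
  /-- the Cartan involution, with fixed point algebra the Lie algebra of `K` -/
  θ : GroupLieAlgebra 𝓘(ℝ, E) G ≃ₗ⁅ℝ⁆ GroupLieAlgebra 𝓘(ℝ, E) G
  θ_invol : ∀ X, θ (θ X) = X
  θ_neg : ∀ X, X ≠ 0 → killingForm ℝ (GroupLieAlgebra 𝓘(ℝ, E) G) X (θ X) < 0
  θ_fixed : ∀ X, θ X = X ↔ InLieAlgebraOf K X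
  /-- a maximal abelian subspace of the `-1`-eigenspace of `θ` -/
  𝔞 : Submodule ℝ (GroupLieAlgebra 𝓘(ℝ, E) G)
  θ_𝔞 : ∀ H ∈ 𝔞, θ H = -H
  𝔞_abelian : ∀ H ∈ 𝔞, ∀ H' ∈ 𝔞, ⁅H, H'⁆ = 0
  𝔞_maximal : ∀ X, θ X = -X → (∀ H ∈ 𝔞, ⁅H, X⁆ = 0) → X ∈ 𝔞
  /-- an element of `𝔞` on which no restricted root vanishes -/
  H₀ : 𝔞
  H₀_regular : ∀ α : Module.Dual ℝ 𝔞, α ≠ 0 → (∃ X, X ≠ 0 ∧ IsWeightVector 𝔞 α X) → α H₀ ≠ 0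
  /-- every `g ∈ G` can be written uniquely as `g = k exp(H) n` -/
  decomp : ∀ g : G, ∃! q : K × 𝔞 ×
      expSubgroup (positivePart 𝔞 H₀ : Set (GroupLieAlgebra 𝓘(ℝ, E) G)),
    ∃ a : G, IsExp (q.2.1 : GroupLieAlgebra 𝓘(ℝ, E) G) a ∧ g = (q.1 : G) * a * (q.2.2 : G)

/-! ## Unitary representations and `K`-types -/

/-- A (strongly continuous) unitary representation of the topological group `S` on `V`. -/
structure UnitaryRep (S : Type*) [Group S] [TopologicalSpace S] (V : Type*)
    [NormedAddCommGroup V] [InnerProductSpace ℂ V] where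
  toHom : S →* (V ≃ₗᵢ[ℂ] V)
  continuous_apply : ∀ v, Continuous fun s => toHom s v

namespace UnitaryRep

variable {S : Type*} [Group S] [TopologicalSpace S] {V : Type*}
  [NormedAddCommGroup V] [InnerProductSpace ℂ V]

/-- The operator by which `s` acts. -/
def op (ρ : UnitaryRep S V) (s : S) : V →L[ℂ] V :=
  ((ρ.toHom s).toContinuousLinearEquiv : V →L[ℂ] V)

theorem op_apply (ρ : UnitaryRep S V) (s : S) (v : V) : ρ.op s v = ρ.toHom s v := rfl

theorem op_mul (ρ : UnitaryRep S V) (s t : S) : ρ.op (s * t) = ρ.op s * ρ.op t := by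
  ext v; simp [op_apply]

theorem op_one (ρ : UnitaryRep S V) : ρ.op 1 = 1 := by
  ext v; simp [op_apply]

def IsIrreducible (ρ : UnitaryRep S V) : Prop :=
  Nontrivial V ∧ ∀ W : Submodule ℂ V, (∀ s, ∀ w ∈ W, ρ.op s w ∈ W) → W = ⊥ ∨ W = ⊤

end UnitaryRep

/-- Irreducible unitary representations of `S` on the model spaces `ℂⁿ`. -/
def IrrepModel (S : Type*) [Group S] [TopologicalSpace S] :=
  Σ n : ℕ, {ρ : UnitaryRep S (EuclideanSpace ℂ (Fin n)) // ρ.IsIrreducible}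

/-- Equivalence of representations. -/
def irrepSetoid (S : Type*) [Group S] [TopologicalSpace S] : Setoid (IrrepModel S) where
  r ρ τ := ∃ e : EuclideanSpace ℂ (Fin ρ.1) ≃ₗ[ℂ] EuclideanSpace ℂ (Fin τ.1),
    ∀ s v, e (ρ.2.1.op s v) = τ.2.1.op s (e v)
  iseqv :=
    { refl := fun _ => ⟨LinearEquiv.refl _ _, fun _ _ => rfl⟩
      symm := by
        rintro ρ τ ⟨e, he⟩
        refine ⟨e.symm, fun s v => ?_⟩
        rw [LinearEquiv.symm_apply_eq, he, LinearEquiv.apply_symm_apply]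
      trans := by
        rintro ρ τ υ ⟨e, he⟩ ⟨e', he'⟩
        exact ⟨e.trans e', fun s v => by simp [he, he']⟩ }

/-- The unitary dual of a compact group `S`: the equivalence classes of irreducible unitary
representations (all of which are finite dimensional). -/
def UnitaryDual (S : Type*) [Group S] [TopologicalSpace S] := Quotient (irrepSetoid S)

/-! ## The space `Γ \ G` -/

/-- The space `Γ \ G` of cosets `Γ g`. -/
def LeftQuot {G : Type*} [Group G] (Γ : Subgroup G) : Type _ := Quotient (QuotientGroup.rightRel Γ)

namespace LeftQuot

variable {G : Type*} [Group G] [TopologicalSpace G] (Γ : Subgroup G)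

instance : TopologicalSpace (LeftQuot Γ) :=
  inferInstanceAs (TopologicalSpace (Quotient (QuotientGroup.rightRel Γ)))

instance : MeasurableSpace (LeftQuot Γ) := borel _

instance : BorelSpace (LeftQuot Γ) := ⟨rfl⟩

variable {Γ}

/-- Right translation `Γ x ↦ Γ x g`. -/
def rmul (g : G) : LeftQuot Γ → LeftQuot Γ :=
  Quotient.map (fun x => x * g) (by
    intro a b h
    change QuotientGroup.rightRel Γ _ _ at h
    change QuotientGroup.rightRel Γ _ _
    rw [QuotientGroup.rightRel_apply] at h ⊢
    simpa [mul_assoc] using h)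

theorem continuous_rmul [IsTopologicalGroup G] (g : G) :
    Continuous (rmul g : LeftQuot Γ → LeftQuot Γ) :=
  Continuous.quotient_map' (continuous_mul_const g) _

end LeftQuot

/-- The `C^*`-algebra `A_γ = C(Γ \ G) ⊗ End(V_γ)`. -/
abbrev SymbolAlgebra {G : Type*} [Group G] [TopologicalSpace G] (Γ : Subgroup G) (V : Type*)
    [NormedAddCommGroup V] [InnerProductSpace ℂ V] :=
  C(LeftQuot Γ, V →L[ℂ] V)

section Algebra

variable {G : Type*} [Group G] [TopologicalSpace G] [IsTopologicalGroup G] {Γ K : Subgroup G}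
  {V : Type*} [NormedAddCommGroup V] [InnerProductSpace ℂ V]

/-- The action `(k f)(Γ g) = γ(k) f(Γ g k) γ(k)⁻¹` of `K` on `A_γ`. -/
def kAct (γ : UnitaryRep K V) (k : K) (f : SymbolAlgebra Γ V) : SymbolAlgebra Γ V where
  toFun x := γ.op k * f (LeftQuot.rmul (k : G) x) * γ.op k⁻¹
  continuous_toFun :=
    (continuous_const.mul (f.continuous.comp (LeftQuot.continuous_rmul _))).mul continuous_const

/-- The `K`-finite elements of `A_γ`. -/
def IsKFiniteSymbol (γ : UnitaryRep K V) (f : SymbolAlgebra Γ V) : Prop :=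
  FiniteDimensional ℂ (Submodule.span ℂ (Set.range fun k : K => kAct γ k f))

/-- The subalgebra `A_γ^K` of `K`-invariant elements of `A_γ`. -/
def invariantSubalgebra (Γ : Subgroup G) (γ : UnitaryRep K V) :
    Subalgebra ℂ (SymbolAlgebra Γ V) where
  carrier := {f | ∀ k, kAct γ k f = f}
  mul_mem' := by
    intro a b ha hb k
    have h1 : γ.op k⁻¹ * γ.op k = 1 := by rw [← γ.op_mul, inv_mul_cancel, γ.op_one]
    ext1 x
    have h := congrArg₂ (· * ·) (DFunLike.congr_fun (ha k) x) (DFunLike.congr_fun (hb k) x)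
    refine Eq.trans ?_ h
    change γ.op k * (a _ * b _) * γ.op k⁻¹ =
      γ.op k * a _ * γ.op k⁻¹ * (γ.op k * b _ * γ.op k⁻¹)
    rw [show γ.op k * a (LeftQuot.rmul k x) * γ.op k⁻¹ *
        (γ.op k * b (LeftQuot.rmul k x) * γ.op k⁻¹) =
        γ.op k * a (LeftQuot.rmul k x) * (γ.op k⁻¹ * γ.op k) * b (LeftQuot.rmul k x) *
          γ.op k⁻¹ by simp only [mul_assoc], h1]
    simp only [mul_assoc, one_mul]
  add_mem' := by
    intro a b ha hb k
    ext1 x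
    have h := congrArg₂ (· + ·) (DFunLike.congr_fun (ha k) x) (DFunLike.congr_fun (hb k) x)
    refine Eq.trans ?_ h
    change γ.op k * (a _ + b _) * γ.op k⁻¹ = γ.op k * a _ * γ.op k⁻¹ + γ.op k * b _ * γ.op k⁻¹
    rw [mul_add, add_mul]
  algebraMap_mem' := by
    intro c k
    have h1 : γ.op k * γ.op k⁻¹ = 1 := by rw [← γ.op_mul, mul_inv_cancel, γ.op_one]
    ext1 x
    change γ.op k * (c • 1) * γ.op k⁻¹ = c • 1
    rw [mul_smul_comm, smul_mul_assoc, mul_one, h1]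

/-- `σ` restricts to a state on the subalgebra `B` of `A_γ`: it is linear on `B`, nonnegative on
the (pointwise) positive elements of `B`, and `σ(1) = 1`. -/
structure IsStateOn (B : Subalgebra ℂ (SymbolAlgebra Γ V)) (σ : SymbolAlgebra Γ V → ℂ) :
    Prop where
  map_add : ∀ f ∈ B, ∀ g ∈ B, σ (f + g) = σ f + σ g
  map_smul : ∀ c : ℂ, ∀ f ∈ B, σ (c • f) = c * σ f
  nonneg : ∀ f ∈ B, (∀ x, (f x).IsPositive) → 0 ≤ (σ f).re ∧ (σ f).im = 0
  map_one : σ 1 = 1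

/-- The functional `f ↦ ∫ ⟨u(x), f(x) v(x)⟩ dx` on `A_γ`. -/
def matrixFunctional (μ : Measure (LeftQuot Γ)) (u v : LeftQuot Γ → V) (f : SymbolAlgebra Γ V) :
    ℂ :=
  ∫ x, inner ℂ (u x) (f x (v x)) ∂μ

/-- The functional `σ_u(f) = ∫ ⟨u(x), f(x) u(x)⟩ dx`. -/
def vectorFunctional (μ : Measure (LeftQuot Γ)) (u : LeftQuot Γ → V) (f : SymbolAlgebra Γ V) : ℂ :=
  matrixFunctional μ u u f

end Algebra

namespace IwasawaDecomposition

variable {E : Type*} [NormedAddCommGroup E] [NormedSpace ℝ E] [CompleteSpace E]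
  {G : Type*} [TopologicalSpace G] [ChartedSpace E G] [Group G]
  [LieGroup 𝓘(ℝ, E) (minSmoothness ℝ 3) G]

section Structure

variable (D : IwasawaDecomposition E G)

instance : CompactSpace D.K := isCompact_iff_compactSpace.mp D.isCompact_K

/-- The Lie algebra `𝔫` of `N`. -/
def 𝔫 : Submodule ℝ (GroupLieAlgebra 𝓘(ℝ, E) G) := positivePart D.𝔞 D.H₀

/-- The subgroup `A`. -/
def A : Subgroup G := expSubgroup (D.𝔞 : Set (GroupLieAlgebra 𝓘(ℝ, E) G))

/-- The group `M = Z_K(A)`. -/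
def M : Subgroup D.K := (Subgroup.centralizer (D.A : Set G)).subgroupOf D.K

/-- The component `k(g) ∈ K` of `g = k(g) a(g) n(g)`. -/
def kPart (g : G) : D.K := (D.decomp g).choose.1

/-- The logarithm `log a(g) ∈ 𝔞` of the component `a(g) ∈ A` of `g = k(g) a(g) n(g)`. -/
def logPart (g : G) : D.𝔞 := (D.decomp g).choose.2.1

/-- `ρ(H) = ½ tr (ad H | 𝔫)`. -/
def rho (H : D.𝔞) : ℝ :=
  (1 / 2) * LinearMap.trace ℝ D.𝔫
    ((LieAlgebra.ad ℝ (GroupLieAlgebra 𝓘(ℝ, E) G) (H : GroupLieAlgebra 𝓘(ℝ, E) G)).restrict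
      (lie_mem_positivePart D.𝔞 D.H₀ H))

/-- The norm on `𝔞^*` dual to the norm on `𝔞` given by the Killing form. -/
def dualNorm (l : Module.Dual ℝ D.𝔞) : ℝ :=
  sSup {r | ∃ H : D.𝔞, killingForm ℝ (GroupLieAlgebra 𝓘(ℝ, E) G) (H : GroupLieAlgebra 𝓘(ℝ, E) G)
    (H : GroupLieAlgebra 𝓘(ℝ, E) G) ≤ 1 ∧ r = |l H|}

/-- `l ∈ 𝔞^*` is regular: only the trivial element of the Weyl group `N_K(A) / M` fixes `l`. -/
def IsRegular (l : Module.Dual ℝ D.𝔞) : Prop :=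
  ∀ k : D.K, (∀ a : G, a ∈ D.A ↔ (k : G) * a * (k : G)⁻¹ ∈ D.A) →
    (∀ H H' : D.𝔞, adjointAction (k : G) (H : GroupLieAlgebra 𝓘(ℝ, E) G) = H' → l H' = l H) →
    k ∈ D.M

/-- `lam n → ∞` in `𝔞^*`, and the rays `[lam n]` converge to the ray of the unit vector `l`. -/
def TendstoRay (lam : ℕ → Module.Dual ℝ D.𝔞) (l : Module.Dual ℝ D.𝔞) : Prop :=
  Tendsto (fun n => D.dualNorm (lam n)) atTop atTop ∧
    ∀ H : D.𝔞, Tendsto (fun n => lam n H / D.dualNorm (lam n)) atTop (𝓝 (l H))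

end Structure

section PrincipalSeries

variable [IsTopologicalGroup G] [MeasurableSpace G] [BorelSpace G] [SecondCountableTopology G]
  (D : IwasawaDecomposition E G)
  {Vκ : Type*} [NormedAddCommGroup Vκ] [InnerProductSpace ℂ Vκ]

instance : SecondCountableTopology D.K :=
  Topology.IsEmbedding.subtypeVal.secondCountableTopology

/-- The Haar measure on `K` of total mass one. -/
def haarK : Measure D.K := Measure.haarMeasure ⊤

instance : IsFiniteMeasure D.haarK := ⟨by
  rw [haarK]; exact (isCompact_univ (X := D.K)).measure_lt_top⟩

instance : D.haarK.IsHaarMeasure := by rw [haarK]; infer_instance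

/-- The Hilbert space `L²(K ×_M V_κ)`: classes of square integrable `φ : K → V_κ` such that
`φ(k m) = κ(m)⁻¹ φ(k)`. -/
def psSpace (κ : UnitaryRep D.M Vκ) : Submodule ℂ (Lp Vκ 2 D.haarK) where
  carrier := {φ | ∀ m : D.M, ∀ᵐ k ∂D.haarK, φ (k * (m : D.K)) = κ.op m⁻¹ (φ k)}
  zero_mem' := by
    intro m
    have h0 := Lp.coeFn_zero Vκ 2 D.haarK
    have h := (quasiMeasurePreserving_mul_right D.haarK (m : D.K)).ae h0
    filter_upwards [h0, h] with k h1 h2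
    rw [h1, h2]; simp
  add_mem' := by
    intro a b ha hb m
    have h0 := Lp.coeFn_add a b
    have h := (quasiMeasurePreserving_mul_right D.haarK (m : D.K)).ae h0
    filter_upwards [h0, h, ha m, hb m] with k h1 h2 h3 h4
    rw [h1, h2]; simp [h3, h4]
  smul_mem' := by
    intro c a ha m
    have h0 := Lp.coeFn_smul c a
    have h := (quasiMeasurePreserving_mul_right D.haarK (m : D.K)).ae h0
    filter_upwards [h0, h, ha m] with k h1 h2 h3
    rw [h1, h2]; simp [h3]

/-- The principal series action
`(π^{κ,iλ}(g) φ)(k) = a(g⁻¹ k)^{iλ - ρ} φ(k(g⁻¹ k))`. -/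
def psAction (lam : Module.Dual ℝ D.𝔞) (g : G) (φ : D.K → Vκ) (k : D.K) : Vκ :=
  Complex.exp (Complex.I * (lam (D.logPart (g⁻¹ * k)) : ℂ) - (D.rho (D.logPart (g⁻¹ * k)) : ℂ)) •
    φ (D.kPart (g⁻¹ * k))

/-- A unitary embedding `ξ : H^{κ,iλ} → L²(Γ \ G)`, i.e. a linear isometry which intertwines
`π^{κ,iλ}` with the action of `G` by right translations. -/
structure UnitaryEmbedding (κ : UnitaryRep D.M Vκ) (lam : Module.Dual ℝ D.𝔞) {Γ : Subgroup G}
    (μ : Measure (LeftQuot Γ)) where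
  toIsometry : D.psSpace κ →ₗᵢ[ℂ] Lp ℂ 2 μ
  equivariant : ∀ (g : G) (φ φ' : D.psSpace κ),
    ((φ' : Lp Vκ 2 D.haarK) : D.K → Vκ) =ᵐ[D.haarK]
      D.psAction lam g ((φ : Lp Vκ 2 D.haarK) : D.K → Vκ) →
    (toIsometry φ' : LeftQuot Γ → ℂ) =ᵐ[μ] fun x => toIsometry φ (LeftQuot.rmul g x)

/-- The set `L(κ)` of rays (identified with unit vectors in `𝔞^*`) which are limits of parameters
`λ_n → ∞` of embedded principal series representations. -/
def limitRays (κ : UnitaryRep D.M Vκ) {Γ : Subgroup G} (μ : Measure (LeftQuot Γ)) :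
    Set (Module.Dual ℝ D.𝔞) :=
  {l | D.dualNorm l = 1 ∧ ∃ lam : ℕ → Module.Dual ℝ D.𝔞,
    D.TendstoRay lam l ∧ ∀ n, Nonempty (D.UnitaryEmbedding κ (lam n) μ)}

end PrincipalSeries

section Sections

variable (D : IwasawaDecomposition E G)
  {Vκ : Type*} [NormedAddCommGroup Vκ] [InnerProductSpace ℂ Vκ]
  (Vγ : Type*) [NormedAddCommGroup Vγ] [InnerProductSpace ℂ Vγ]

/-- The space `C(K ×_M V_κ) ⊗ V_γ`: continuous `φ : K → V_κ ⊗ V_γ` such that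
`φ(k m) = (κ(m)⁻¹ ⊗ 1) φ(k)`. -/
def sections (κ : UnitaryRep D.M Vκ) : Submodule ℂ C(D.K, Vκ ⊗[ℂ] Vγ) where
  carrier := {φ | ∀ (k : D.K) (m : D.M),
    φ (k * (m : D.K)) = TensorProduct.map (κ.op m⁻¹ : Vκ →ₗ[ℂ] Vκ) LinearMap.id (φ k)}
  zero_mem' := by intro k m; simp
  add_mem' := by
    intro a b ha hb k m
    simp only [ContinuousMap.add_apply, map_add, ha k m, hb k m]
  smul_mem' := by
    intro c a ha k m
    simp only [ContinuousMap.smul_apply, map_smul, ha k m]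

variable {Vγ} {D}

/-- `φ` is `K`-finite: its left translates `x ↦ φ(k⁻¹ x)` span a finite dimensional space. The
`K`-finite sections are exactly the elements of `C^K(K ×_M V_κ) ⊗ V_γ`. -/
def IsKFiniteSection {κ : UnitaryRep D.M Vκ} (φ : D.sections Vγ κ) : Prop :=
  FiniteDimensional ℂ (Submodule.span ℂ
    (Set.range fun k : D.K => fun x : D.K => (φ : C(D.K, Vκ ⊗[ℂ] Vγ)) (k⁻¹ * x)))

/-- The isotypic subspace of `C(K ×_M V_κ) ⊗ V_γ` of type `ν`, with respect to left translations:
the span of the images of all intertwining operators from `ν`. -/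
def isotypicSections (κ : UnitaryRep D.M Vκ) (ν : UnitaryDual D.K) :
    Submodule ℂ (D.sections Vγ κ) :=
  Submodule.span ℂ {φ | ∃ L : EuclideanSpace ℂ (Fin ν.out.1) →ₗ[ℂ] D.sections Vγ κ,
    (∀ (k x : D.K) v, (L (ν.out.2.1.op k v) : C(D.K, Vκ ⊗[ℂ] Vγ)) x =
      (L v : C(D.K, Vκ ⊗[ℂ] Vγ)) (k⁻¹ * x)) ∧ ∃ v, L v = φ}

/-- The space `[V_κ ⊗ V_γ]^M`. -/
def mInvariants (κ : UnitaryRep D.M Vκ) (γ : UnitaryRep D.K Vγ) : Submodule ℂ (Vκ ⊗[ℂ] Vγ) where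
  carrier := {T | ∀ m : D.M,
    TensorProduct.map (κ.op m : Vκ →ₗ[ℂ] Vκ) (γ.op (m : D.K) : Vγ →ₗ[ℂ] Vγ) T = T}
  zero_mem' := by intro m; simp
  add_mem' := by intro a b ha hb m; rw [map_add, ha m, hb m]
  smul_mem' := by intro c a ha m; rw [map_smul, ha m]

theorem continuous_map_op (γ : UnitaryRep D.K Vγ) (T : Vκ ⊗[ℂ] Vγ) :
    Continuous fun k : D.K =>
      TensorProduct.map LinearMap.id (γ.op k : Vγ →ₗ[ℂ] Vγ) T := by
  induction T using TensorProduct.induction_on with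
  | zero => simpa using continuous_const
  | tmul a b =>
    simp only [TensorProduct.map_tmul]
    exact TensorProduct.continuous_tmul.comp
      (continuous_const.prodMk (γ.continuous_apply b))
  | add a b ha hb => simp only [map_add]; exact ha.add hb

/-- The `K`-invariant element `ψ_T` of `C^∞(K ×_M V_κ) ⊗ V_γ` with `ψ_T(1) = T`, namely
`ψ_T(k) = (1 ⊗ γ(k)) T`. -/
def psiT {κ : UnitaryRep D.M Vκ} {γ : UnitaryRep D.K Vγ} (T : mInvariants κ γ) :
    D.sections Vγ κ where
  val := ⟨fun k => TensorProduct.map LinearMap.id (γ.op k : Vγ →ₗ[ℂ] Vγ) (T : Vκ ⊗[ℂ] Vγ),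
    continuous_map_op γ _⟩
  property := by
    intro k m
    change TensorProduct.map LinearMap.id (γ.op (k * (m : D.K)) : Vγ →ₗ[ℂ] Vγ) T.1 =
      TensorProduct.map (κ.op m⁻¹ : Vκ →ₗ[ℂ] Vκ) LinearMap.id
        (TensorProduct.map LinearMap.id (γ.op k : Vγ →ₗ[ℂ] Vγ) T.1)
    conv_rhs => rw [← T.2 m]
    simp only [← LinearMap.comp_apply, ← TensorProduct.map_comp]
    congr 2
    · change _ = ((κ.op m⁻¹ * κ.op m : Vκ →L[ℂ] Vκ) : Vκ →ₗ[ℂ] Vκ)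
      rw [← κ.op_mul, inv_mul_cancel, κ.op_one]; rfl
    · rw [γ.op_mul]; rfl

/-- The distribution `δ_T : φ ↦ ⟨T, φ(1)⟩`. -/
def deltaT (κ : UnitaryRep D.M Vκ) (T : Vκ ⊗[ℂ] Vγ) (φ : D.sections Vγ κ) : ℂ :=
  inner ℂ T ((φ : C(D.K, Vκ ⊗[ℂ] Vγ)) 1)

end Sections

section Functionals

variable [IsTopologicalGroup G] [MeasurableSpace G] [BorelSpace G] [SecondCountableTopology G]
  {D : IwasawaDecomposition E G}
  {Vκ : Type*} [NormedAddCommGroup Vκ] [InnerProductSpace ℂ Vκ] [FiniteDimensional ℂ Vκ]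
  {Vγ : Type*} [NormedAddCommGroup Vγ] [InnerProductSpace ℂ Vγ] [FiniteDimensional ℂ Vγ]
  {κ : UnitaryRep D.M Vκ} {Γ : Subgroup G} {μ : Measure (LeftQuot Γ)}

/-- `w` is the component of type `ν` of the distribution `Δ`: it lies in the `ν`-isotypic subspace,
and the `L²`-pairing with `w` agrees with `Δ` there. -/
def IsComponent (Δ : D.sections Vγ κ → ℂ) (ν : UnitaryDual D.K) (w : D.sections Vγ κ) : Prop :=
  w ∈ isotypicSections κ ν ∧ ∀ φ ∈ isotypicSections (Vγ := Vγ) κ ν,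
    ∫ k, inner ℂ ((w : C(D.K, Vκ ⊗[ℂ] Vγ)) k) ((φ : C(D.K, Vκ ⊗[ℂ] Vγ)) k) ∂D.haarK = Δ φ

/-- The component of type `ν` of the distribution `Δ`. -/
def component (Δ : D.sections Vγ κ → ℂ) (ν : UnitaryDual D.K) : D.sections Vγ κ :=
  Classical.epsilon (IsComponent Δ ν)

/-- The map `1 ⊗ ⟨v, ·⟩ : V_κ ⊗ V_γ → V_κ`. -/
def contract (Vκ : Type*) [NormedAddCommGroup Vκ] [InnerProductSpace ℂ Vκ]
    [FiniteDimensional ℂ Vκ] (v : Vγ) : Vκ ⊗[ℂ] Vγ →L[ℂ] Vκ :=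
  LinearMap.toContinuousLinearMap ((TensorProduct.rid ℂ Vκ).toLinearMap ∘ₗ
    TensorProduct.map LinearMap.id (innerSL ℂ v : Vγ →ₗ[ℂ] ℂ))

theorem contract_tmul (v : Vγ) (a : Vκ) (b : Vγ) :
    contract Vκ v (a ⊗ₜ[ℂ] b) = inner ℂ v b • a := by
  simp [contract]

theorem contract_map (v : Vγ) (S : Vκ →ₗ[ℂ] Vκ) (t : Vκ ⊗[ℂ] Vγ) :
    contract Vκ v (TensorProduct.map S LinearMap.id t) = S (contract Vκ v t) := by
  induction t using TensorProduct.induction_on with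
  | zero => simp
  | tmul a b => simp [contract_tmul]
  | add a b ha hb => simp only [map_add, ha, hb]

/-- The coordinate `(1 ⊗ ⟨v, ·⟩) φ` of a section `φ`, as an element of `L²(K ×_M V_κ)`. -/
def coordinate (v : Vγ) (φ : D.sections Vγ κ) : D.psSpace κ where
  val := ContinuousMap.toLp 2 D.haarK ℂ
    ⟨fun k => contract Vκ v ((φ : C(D.K, Vκ ⊗[ℂ] Vγ)) k),
      (contract Vκ v).continuous.comp (φ : C(D.K, Vκ ⊗[ℂ] Vγ)).continuous⟩
  property := by
    intro m
    have h0 := ContinuousMap.coeFn_toLp (p := 2) (𝕜 := ℂ) D.haarK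
      (⟨fun k => contract Vκ v ((φ : C(D.K, Vκ ⊗[ℂ] Vγ)) k),
        (contract Vκ v).continuous.comp (φ : C(D.K, Vκ ⊗[ℂ] Vγ)).continuous⟩ : C(D.K, Vκ))
    have h := (quasiMeasurePreserving_mul_right D.haarK (m : D.K)).ae h0
    filter_upwards [h0, h] with k h1 h2
    rw [h1, h2]
    change contract Vκ v ((φ : C(D.K, Vκ ⊗[ℂ] Vγ)) (k * (m : D.K))) = _
    rw [φ.2 k m, contract_map]
    rfl

/-- The extension `ξ ⊗ 1` of `ξ` to `V_γ`-valued elements: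
`(ξ ⊗ 1)(φ) = ∑_j ξ((1 ⊗ ⟨e_j, ·⟩) φ) ⊗ e_j` for an orthonormal basis `e_j` of `V_γ`. -/
def UnitaryEmbedding.extend {lam : Module.Dual ℝ D.𝔞} (ξ : D.UnitaryEmbedding κ lam μ)
    (φ : D.sections Vγ κ) (x : LeftQuot Γ) : Vγ :=
  ∑ j, ξ.toIsometry (coordinate (stdOrthonormalBasis ℂ Vγ j) φ) x • stdOrthonormalBasis ℂ Vγ j

/-- The functional `σ^ξ_{φ,ψ}(f) = ∫ ⟨ξ(φ)(x), f(x) ξ(ψ)(x)⟩ dx` on `A_γ`. -/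
def UnitaryEmbedding.sigma {lam : Module.Dual ℝ D.𝔞} (ξ : D.UnitaryEmbedding κ lam μ)
    (φ ψ : D.sections Vγ κ) (f : SymbolAlgebra Γ Vγ) : ℂ :=
  matrixFunctional μ (ξ.extend φ) (ξ.extend ψ) f

/-- The sequence of unitary embeddings `ξ_n : H^{κ,iλ_n} → L²(Γ \ G)` is `l`-conveniently
arranged (with respect to `V_γ`). -/
structure ConvenientlyArranged (Vγ : Type*) [NormedAddCommGroup Vγ] [InnerProductSpace ℂ Vγ]
    [FiniteDimensional ℂ Vγ] (l : Module.Dual ℝ D.𝔞) {lam : ℕ → Module.Dual ℝ D.𝔞}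
    (ξ : ∀ n, D.UnitaryEmbedding κ (lam n) μ) : Prop where
  tendsto_ray : D.TendstoRay lam l
  regular : ∀ n, D.IsRegular (lam n)
  converges : ∀ φ ψ : D.sections Vγ κ, IsKFiniteSection φ → IsKFiniteSection ψ →
    ∀ f : SymbolAlgebra Γ Vγ, ∃ c : ℂ, Tendsto (fun n => (ξ n).sigma φ ψ f) atTop (𝓝 c)

/-- The weak limit `σ_{φ,ψ}` of the functionals `σ^{ξ_n}_{φ,ψ}`. -/
def limitSigma {lam : ℕ → Module.Dual ℝ D.𝔞} (ξ : ∀ n, D.UnitaryEmbedding κ (lam n) μ)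
    (φ ψ : D.sections Vγ κ) (f : SymbolAlgebra Γ Vγ) : ℂ :=
  limUnder atTop fun n => (ξ n).sigma φ ψ f

/-- The extension of `σ_{φ,ψ}` to distributions `ψ = Δ` in the second variable, as a functional on
the `K`-finite elements `f` of `A_γ`: the (finite) sum over all `K`-types `ν` of
`σ_{φ,Δ_ν}(f)`. -/
def distributionSigma {lam : ℕ → Module.Dual ℝ D.𝔞} (ξ : ∀ n, D.UnitaryEmbedding κ (lam n) μ)
    (φ : D.sections Vγ κ) (Δ : D.sections Vγ κ → ℂ) (f : SymbolAlgebra Γ Vγ) : ℂ :=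
  ∑ᶠ ν : UnitaryDual D.K, limitSigma ξ φ (component Δ ν) f

/-- `σ` is the representation theoretic lift `σ_T` associated to the sequence `ξ_n`: the state on
`A_γ` which extends the functional `σ_{ψ_T,δ_T}` on `K`-finite elements. -/
def IsRepresentationTheoreticLift {γ : UnitaryRep D.K Vγ} {lam : ℕ → Module.Dual ℝ D.𝔞}
    (ξ : ∀ n, D.UnitaryEmbedding κ (lam n) μ) (T : mInvariants κ γ)
    (σ : SymbolAlgebra Γ Vγ →L[ℂ] ℂ) : Prop :=
  IsStateOn ⊤ σ ∧ ∀ f : SymbolAlgebra Γ Vγ, IsKFiniteSymbol γ f →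
    σ f = distributionSigma ξ (psiT T) (deltaT κ (T : Vκ ⊗[ℂ] Vγ)) f

end Functionals

end IwasawaDecomposition

end

/-!
For `f` in `A_γ^K`, the form `(φ, ψ) ↦ σ_{φ,ψ}(f)` on `K`-finite sections is invariant under the
diagonal action `(k φ)(x) = (1 ⊗ γ(k)) φ(k⁻¹ x)` of `K`, since the embeddings `ξ_n` are equivariant
and the measure on `Γ \ G` is invariant (`UnitaryEmbedding.sigma_diagAct`). The section `ψ_T` is
fixed by this action, so `F = σ_{ψ_T,·}(f)` is an invariant linear functional. The heart of the
matter is that `F(δ_T) = F(ψ_T)` for every such functional (`finsum_component_deltaT`); informally,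
the average of `δ_T` over the diagonal action of `K` is `ψ_T`.

This is proved without averaging. Each isotypic subspace of the space of sections is finite
dimensional, so on it `F` is the `L²` pairing with some section `u`, which is invariant because `F`
is. An invariant section has the form `u(k) = (1 ⊗ γ(k)) u(1)`, so that
`⟨T, u(1)⟩ = ∫ ⟨ψ_T(k), u(k)⟩ dk`: the section `u` pairs with the component of `δ_T` as it does with
`ψ_T` (`deltaT_eq_l2Pairing_psiT`). Since `ψ_T` lies in a finite dimensional translation invariant
space, complete reducibility (`UnitaryRep.le_iSup_isotypic`) and the orthogonality of
isotypic subspaces (`UnitaryRep.inner_isotypic_eq_zero`) show that `ψ_T` is the finite sum of its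
components, and summing over all `K`-types gives the claim.

The functionals `σ_{ξ_n(ψ_T)}` are states because `ξ_n ⊗ 1` is isometric and `ψ_T(k)` has norm
`‖T‖ = 1` for all `k`.
-/

set_option linter.unusedSectionVars false

noncomputable section

/-! ### Isotypic subspaces of unitary representations -/

namespace UnitaryRep

variable {S : Type*} [Group S] [TopologicalSpace S] {V : Type*}
  [NormedAddCommGroup V] [InnerProductSpace ℂ V]

theorem inner_op_op (ρ : UnitaryRep S V) (s : S) (v w : V) :
    inner ℂ (ρ.op s v) (ρ.op s w) = inner ℂ v w := by
  rw [op_apply, op_apply, LinearIsometryEquiv.inner_map_map]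

theorem op_op_inv (ρ : UnitaryRep S V) (s : S) (v : V) : ρ.op s (ρ.op s⁻¹ v) = v := by
  have h := congrArg (fun A : V →L[ℂ] V => A v) (ρ.op_mul s s⁻¹)
  rw [mul_inv_cancel, ρ.op_one] at h
  exact h.symm

theorem op_inv_op (ρ : UnitaryRep S V) (s : S) (v : V) : ρ.op s⁻¹ (ρ.op s v) = v := by
  simpa using ρ.op_op_inv s⁻¹ v

/-- The subspace `W` is stable under the representation `ρ`. -/
def IsStable (ρ : UnitaryRep S V) (W : Submodule ℂ V) : Prop := ∀ s, ∀ w ∈ W, ρ.op s w ∈ W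

/-- The isotypic subspace of type `ν`: the span of the images of all intertwining operators from
the chosen representative of `ν`. -/
def isotypic (ρ : UnitaryRep S V) (ν : UnitaryDual S) : Submodule ℂ V :=
  Submodule.span ℂ {φ | ∃ L : EuclideanSpace ℂ (Fin ν.out.1) →ₗ[ℂ] V,
    (∀ s v, L (ν.out.2.1.op s v) = ρ.op s (L v)) ∧ ∃ v, L v = φ}

/-- Schur's lemma for inequivalent irreducible representations. -/
theorem intertwiner_eq_zero (a b : IrrepModel S) (hab : ¬ (irrepSetoid S).r a b)
    (A : EuclideanSpace ℂ (Fin a.1) →ₗ[ℂ] EuclideanSpace ℂ (Fin b.1))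
    (hA : ∀ s v, A (a.2.1.op s v) = b.2.1.op s (A v)) : A = 0 := by
  rcases a.2.2.2 (LinearMap.ker A) (fun s w hw => by
    rw [LinearMap.mem_ker] at hw ⊢; rw [hA, hw, map_zero]) with hk | hk
  · rcases b.2.2.2 (LinearMap.range A) (by
      rintro s _ ⟨v, rfl⟩; exact ⟨a.2.1.op s v, hA s v⟩) with hr | hr
    · exact LinearMap.range_eq_bot.mp hr
    · exact absurd ⟨LinearEquiv.ofBijective A
        ⟨LinearMap.ker_eq_bot.mp hk, LinearMap.range_eq_top.mp hr⟩, hA⟩ hab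
  · exact LinearMap.ker_eq_top.mp hk

/-- Isotypic subspaces of different types are orthogonal: for intertwining operators `L`, `L'` from
two inequivalent irreducible representations, `L^* L'` is an intertwining operator between
these, hence zero. -/
theorem inner_isotypic_eq_zero (ρ : UnitaryRep S V) {ν ν' : UnitaryDual S} (h : ν ≠ ν')
    {φ ψ : V} (hφ : φ ∈ ρ.isotypic ν) (hψ : ψ ∈ ρ.isotypic ν') : inner ℂ φ ψ = 0 := by
  have key : ∀ (L : EuclideanSpace ℂ (Fin ν.out.1) →ₗ[ℂ] V)
      (_ : ∀ s v, L (ν.out.2.1.op s v) = ρ.op s (L v))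
      (L' : EuclideanSpace ℂ (Fin ν'.out.1) →ₗ[ℂ] V)
      (_ : ∀ s v, L' (ν'.out.2.1.op s v) = ρ.op s (L' v)) (v v'),
      inner ℂ (L v) (L' v') = 0 := by
    intro L hL L' hL' v v'
    let e := EuclideanSpace.basisFun (Fin ν.out.1) ℂ
    -- `A` is the operator `L^* L'`, written in coordinates since `V` need not be complete.
    let A : EuclideanSpace ℂ (Fin ν'.out.1) →ₗ[ℂ] EuclideanSpace ℂ (Fin ν.out.1) :=
      ∑ i, LinearMap.smulRight ((innerSL ℂ (L (e i)) : V →ₗ[ℂ] ℂ) ∘ₗ L') (e i)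
    have hA : ∀ v v', inner ℂ v (A v') = inner ℂ (L v) (L' v') := by
      intro v v'
      conv_rhs => rw [← e.sum_repr v]
      simp only [A, LinearMap.sum_apply, LinearMap.smulRight_apply, LinearMap.comp_apply,
        ContinuousLinearMap.coe_coe, innerSL_apply_apply, inner_sum, inner_smul_right, map_sum,
        map_smul, sum_inner, inner_smul_left]
      refine Finset.sum_congr rfl fun i _ => ?_
      rw [e.repr_apply_apply, inner_conj_symm, mul_comm]
    have hA0 : A = 0 := by
      refine intertwiner_eq_zero _ _ (fun hr => h ?_) A fun s v' => ?_
      · exact (Quotient.out_eq ν).symm.trans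
          ((Quotient.sound (s := irrepSetoid S) hr).symm.trans (Quotient.out_eq ν'))
      · refine ext_inner_left ℂ fun v => ?_
        rw [hA, hL', ← ν.out.2.1.op_op_inv s v, inner_op_op, hA, hL, inner_op_op]
    rw [← hA, hA0]; simp
  induction hφ using Submodule.span_induction with
  | mem φ hφ =>
    obtain ⟨L, hL, v, rfl⟩ := hφ
    induction hψ using Submodule.span_induction with
    | mem ψ hψ => obtain ⟨L', hL', v', rfl⟩ := hψ; exact key L hL L' hL' v v'
    | zero => simp
    | add a b _ _ ha hb => rw [inner_add_right, ha, hb, add_zero]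
    | smul c a _ ha => rw [inner_smul_right, ha, mul_zero]
  | zero => simp
  | add a b _ _ ha hb => rw [inner_add_left, ha, hb, add_zero]
  | smul c a _ ha => rw [inner_smul_left, ha, mul_zero]

/-- An isotypic subspace is mapped into itself by every linear map that commutes with the
representation. -/
theorem map_mem_isotypic (ρ : UnitaryRep S V) (ν : UnitaryDual S) (B : V →ₗ[ℂ] V)
    (hB : ∀ s v, B (ρ.op s v) = ρ.op s (B v)) {φ : V} (hφ : φ ∈ ρ.isotypic ν) :
    B φ ∈ ρ.isotypic ν := by
  induction hφ using Submodule.span_induction with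
  | mem φ hφ =>
    obtain ⟨L, hL, v, rfl⟩ := hφ
    exact Submodule.subset_span ⟨B ∘ₗ L, fun s v => by simp [hL, hB], v, rfl⟩
  | zero => rw [map_zero]; exact Submodule.zero_mem _
  | add a b _ _ ha hb => rw [map_add]; exact Submodule.add_mem _ ha hb
  | smul c a _ ha => rw [map_smul]; exact Submodule.smul_mem _ _ ha

theorem isStable_isotypic (ρ : UnitaryRep S V) (ν : UnitaryDual S) :
    ρ.IsStable (ρ.isotypic ν) := by
  intro s φ hφ
  induction hφ using Submodule.span_induction with
  | mem φ hφ =>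
    obtain ⟨L, hL, v, rfl⟩ := hφ
    exact Submodule.subset_span ⟨L, hL, ν.out.2.1.op s v, hL s v⟩
  | zero => rw [map_zero]; exact Submodule.zero_mem _
  | add a b _ _ ha hb => rw [map_add]; exact Submodule.add_mem _ ha hb
  | smul c a _ ha => rw [map_smul]; exact Submodule.smul_mem _ _ ha

/-- The restriction of a unitary representation to a stable subspace. -/
def restrict (ρ : UnitaryRep S V) {W : Submodule ℂ V} (hW : ρ.IsStable W) : UnitaryRep S W where
  toHom :=
    { toFun := fun s =>
        { toFun := fun w => ⟨ρ.op s w, hW s w w.2⟩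
          invFun := fun w => ⟨ρ.op s⁻¹ w, hW s⁻¹ w w.2⟩
          map_add' := fun v w => by ext; simp
          map_smul' := fun c w => by ext; simp
          left_inv := fun w => by ext; simp [op_inv_op]
          right_inv := fun w => by ext; simp [op_op_inv]
          norm_map' := fun w => by
            change ‖ρ.op s w‖ = ‖(w : V)‖
            rw [op_apply, LinearIsometryEquiv.norm_map] }
      map_one' := by ext w; change ρ.op 1 w = w; rw [op_one]; rfl
      map_mul' := fun s t => by
        ext w; change ρ.op (s * t) w = ρ.op s (ρ.op t w); rw [op_mul]; rfl }
  continuous_apply w := Continuous.subtype_mk (ρ.continuous_apply w) _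

/-- The restriction of a unitary representation to a stable finite dimensional subspace,
transported to a model space by an orthonormal basis. -/
def modelRep (ρ : UnitaryRep S V) {W : Submodule ℂ V} (hW : ρ.IsStable W) {n : ℕ}
    (b : OrthonormalBasis (Fin n) ℂ W) : UnitaryRep S (EuclideanSpace ℂ (Fin n)) where
  toHom :=
    { toFun := fun s => (b.repr.symm.trans ((ρ.restrict hW).toHom s)).trans b.repr
      map_one' := by ext1 v; simp
      map_mul' := fun s t => by ext1 v; simp }
  continuous_apply v :=
    b.repr.continuous.comp ((ρ.restrict hW).continuous_apply (b.repr.symm v))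

theorem repr_symm_modelRep (ρ : UnitaryRep S V) {W : Submodule ℂ V} (hW : ρ.IsStable W) {n : ℕ}
    (b : OrthonormalBasis (Fin n) ℂ W) (s : S) (v : EuclideanSpace ℂ (Fin n)) :
    (b.repr.symm ((ρ.modelRep hW b).op s v) : V) = ρ.op s (b.repr.symm v : V) := by
  have h : (ρ.modelRep hW b).op s v = b.repr ((ρ.restrict hW).toHom s (b.repr.symm v)) := rfl
  rw [h, LinearIsometryEquiv.symm_apply_apply]
  rfl

/-- A stable finite dimensional subspace without proper stable subspaces lies in an isotypic
subspace. -/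
theorem le_isotypic_of_irreducible (ρ : UnitaryRep S V) (W : Submodule ℂ V)
    [FiniteDimensional ℂ W] (hW : ρ.IsStable W) (h0 : W ≠ ⊥)
    (hirr : ∀ U ≤ W, ρ.IsStable U → U = ⊥ ∨ U = W) : ∃ ν, W ≤ ρ.isotypic ν := by
  let b := stdOrthonormalBasis ℂ W
  let J : EuclideanSpace ℂ (Fin (Module.finrank ℂ W)) →ₗ[ℂ] V :=
    W.subtype ∘ₗ b.repr.symm.toLinearEquiv.toLinearMap
  have hJ : ∀ s v, J ((ρ.modelRep hW b).op s v) = ρ.op s (J v) := ρ.repr_symm_modelRep hW b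
  have hJinj : Function.Injective J := W.injective_subtype.comp b.repr.symm.injective
  have hJr : LinearMap.range J = W := by
    rw [LinearMap.range_comp_of_range_eq_top _ (LinearEquiv.range _), Submodule.range_subtype]
  have hmodel : (ρ.modelRep hW b).IsIrreducible := by
    refine ⟨?_, fun U hU => ?_⟩
    · have : Nontrivial W := Submodule.nontrivial_iff_ne_bot.mpr h0
      exact b.repr.symm.toEquiv.nontrivial
    · rcases hirr (U.map J) (LinearMap.map_le_range.trans hJr.le) (by
        rintro s _ ⟨u, hu, rfl⟩
        exact ⟨_, hU s u hu, hJ s u⟩) with h | h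
      · exact .inl (Submodule.map_injective_of_injective hJinj (h.trans (Submodule.map_bot J).symm))
      · refine .inr (Submodule.map_injective_of_injective hJinj ?_)
        rw [h, Submodule.map_top, hJr]
  let a : IrrepModel S := ⟨_, _, hmodel⟩
  refine ⟨Quotient.mk (irrepSetoid S) a, fun w hw => ?_⟩
  obtain ⟨e, he⟩ := Quotient.mk_out (s := irrepSetoid S) a
  rw [← hJr] at hw
  obtain ⟨v, rfl⟩ := hw
  refine Submodule.subset_span ⟨J ∘ₗ e.toLinearMap, fun s v => ?_, e.symm v, by simp⟩
  exact (congrArg J (he s v)).trans (hJ s _)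

/-- Complete reducibility: a stable finite dimensional subspace is contained in the sum of the
isotypic subspaces. -/
theorem le_iSup_isotypic (ρ : UnitaryRep S V) (W : Submodule ℂ V)
    [FiniteDimensional ℂ W] (hW : ρ.IsStable W) : W ≤ ⨆ ν, ρ.isotypic ν := by
  induction hn : Module.finrank ℂ W using Nat.strong_induction_on generalizing W with
  | _ n ih =>
    subst hn
    by_cases h0 : W = ⊥
    · rw [h0]; exact bot_le
    by_cases hirr : ∀ U ≤ W, ρ.IsStable U → U = ⊥ ∨ U = W
    · obtain ⟨ν, hν⟩ := ρ.le_isotypic_of_irreducible W hW h0 hirr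
      exact hν.trans (le_iSup _ ν)
    push Not at hirr
    obtain ⟨U, hUW, hU, hU0, hU1⟩ := hirr
    have : FiniteDimensional ℂ U := Submodule.finiteDimensional_of_le hUW
    have : FiniteDimensional ℂ (Uᗮ ⊓ W : Submodule ℂ V) :=
      Submodule.finiteDimensional_of_le inf_le_right
    have hC : ρ.IsStable (Uᗮ ⊓ W) := by
      refine fun s w hw => ⟨fun u hu => ?_, hW s w hw.2⟩
      rw [← ρ.op_op_inv s u, inner_op_op]
      exact hw.1 _ (hU _ _ hu)
    have hsup : U ⊔ Uᗮ ⊓ W = W := Submodule.sup_orthogonal_inf_of_hasOrthogonalProjection hUW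
    -- `W` is the orthogonal sum of the smaller stable subspaces `U` and `Uᗮ ⊓ W`.
    rw [← hsup]
    refine sup_le (ih _ ?_ U hU rfl) (ih _ ?_ _ hC rfl)
    · exact Submodule.finrank_lt_finrank_of_lt (lt_of_le_of_ne hUW hU1)
    · refine Submodule.finrank_lt_finrank_of_lt (lt_of_le_of_ne inf_le_right fun h => hU0 ?_)
      exact (Submodule.eq_bot_iff _).mpr fun u hu =>
        inner_self_eq_zero.mp ((inf_eq_right.mp h) (hUW hu) u hu)

end UnitaryRep

/-! ### Continuous sections and the `L²` inner product -/

/-- Every linear functional on a finite dimensional subspace of an inner product space is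
represented by a vector of the subspace. -/
theorem exists_inner_eq_on {H : Type*} [NormedAddCommGroup H] [InnerProductSpace ℂ H]
    (W : Submodule ℂ H) [FiniteDimensional ℂ W] (F : H →ₗ[ℂ] ℂ) :
    ∃ u ∈ W, ∀ φ ∈ W, inner ℂ u φ = F φ := by
  refine ⟨(InnerProductSpace.toDual ℂ W).symm (LinearMap.toContinuousLinearMap (F.domRestrict W)),
    Subtype.mem _, fun φ hφ => ?_⟩
  have h := InnerProductSpace.toDual_symm_apply (𝕜 := ℂ) (x := (⟨φ, hφ⟩ : W))
    (y := LinearMap.toContinuousLinearMap (F.domRestrict W))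
  rwa [Submodule.coe_inner] at h

namespace IwasawaDecomposition

variable {E : Type*} [NormedAddCommGroup E] [NormedSpace ℝ E] [CompleteSpace E]
  {G : Type*} [TopologicalSpace G] [ChartedSpace E G] [Group G]
  [LieGroup 𝓘(ℝ, E) (minSmoothness ℝ 3) G]

section Translation

variable [IsTopologicalGroup G] {D : IwasawaDecomposition E G}
  {Vκ : Type*} [NormedAddCommGroup Vκ] [InnerProductSpace ℂ Vκ]
  {Vγ : Type*} [NormedAddCommGroup Vγ] [InnerProductSpace ℂ Vγ]
  {κ : UnitaryRep D.M Vκ}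

/-- Left translation of sections, `(k φ)(x) = φ(k⁻¹ x)`. -/
def translate (k : D.K) : D.sections Vγ κ →ₗ[ℂ] D.sections Vγ κ where
  toFun φ := ⟨⟨fun x => φ.1 (k⁻¹ * x), by fun_prop⟩, fun x m => by
    simpa [mul_assoc] using φ.2 (k⁻¹ * x) m⟩
  map_add' _ _ := rfl
  map_smul' _ _ := rfl

theorem translate_apply (k : D.K) (φ : D.sections Vγ κ) (x : D.K) :
    (translate k φ).1 x = φ.1 (k⁻¹ * x) := rfl

theorem continuous_translate (φ : D.sections Vγ κ) :
    Continuous fun k : D.K => translate k φ := by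
  refine Continuous.subtype_mk ?_ _
  exact ContinuousMap.continuous_of_continuous_uncurry _
    (by change Continuous fun p : D.K × D.K => φ.1 (p.1⁻¹ * p.2); fun_prop)

/-- The operator `1 ⊗ B` on sections, for `B` in `End(V_γ)`. -/
def fiberMap [FiniteDimensional ℂ Vκ] [FiniteDimensional ℂ Vγ] (B : Vγ →ₗ[ℂ] Vγ) :
    D.sections Vγ κ →ₗ[ℂ] D.sections Vγ κ where
  toFun φ := ⟨⟨fun x => TensorProduct.map LinearMap.id B (φ.1 x),
    (LinearMap.continuous_of_finiteDimensional _).comp φ.1.continuous⟩, fun x m => by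
      change TensorProduct.map LinearMap.id B (φ.1 (x * m)) =
        TensorProduct.map _ LinearMap.id (TensorProduct.map LinearMap.id B (φ.1 x))
      rw [φ.2 x m, ← LinearMap.comp_apply, ← LinearMap.comp_apply, ← TensorProduct.map_comp,
        ← TensorProduct.map_comp]
      simp⟩
  map_add' φ ψ := by ext x; exact map_add (TensorProduct.map LinearMap.id B) _ _
  map_smul' c φ := by ext x; exact map_smul (TensorProduct.map LinearMap.id B) _ _

theorem fiberMap_apply [FiniteDimensional ℂ Vκ] [FiniteDimensional ℂ Vγ] (B : Vγ →ₗ[ℂ] Vγ)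
    (φ : D.sections Vγ κ) (x : D.K) :
    (fiberMap B φ).1 x = TensorProduct.map LinearMap.id B (φ.1 x) := rfl

/-- A section in a finite dimensional translation invariant space is `K`-finite. -/
theorem isKFiniteSection_of_mem (W : Submodule ℂ (D.sections Vγ κ)) [FiniteDimensional ℂ W]
    (hW : ∀ k, ∀ φ ∈ W, translate k φ ∈ W) {φ : D.sections Vγ κ} (hφ : φ ∈ W) :
    IsKFiniteSection φ := by
  let ev : D.sections Vγ κ →ₗ[ℂ] D.K → Vκ ⊗[ℂ] Vγ :=
    { toFun := fun φ x => φ.1 x, map_add' := fun _ _ => rfl, map_smul' := fun _ _ => rfl }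
  refine Submodule.finiteDimensional_of_le (S₂ := W.map ev) (Submodule.span_le.mpr ?_)
  rintro _ ⟨k, rfl⟩
  exact ⟨translate k φ, hW k φ hφ, rfl⟩

/-- The subspace of `K`-finite sections. -/
def kFiniteSections (κ : UnitaryRep D.M Vκ) (Vγ : Type*) [NormedAddCommGroup Vγ]
    [InnerProductSpace ℂ Vγ] : Submodule ℂ (D.sections Vγ κ) where
  carrier := {φ | IsKFiniteSection φ}
  zero_mem' := isKFiniteSection_of_mem ⊥ (by simp) (Submodule.zero_mem _)
  add_mem' := by
    intro a b (ha : FiniteDimensional ℂ _) (hb : FiniteDimensional ℂ _)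
    refine Submodule.finiteDimensional_of_le (S₂ := Submodule.span ℂ
      (Set.range fun k : D.K => fun x : D.K => a.1 (k⁻¹ * x)) ⊔ Submodule.span ℂ
      (Set.range fun k : D.K => fun x : D.K => b.1 (k⁻¹ * x))) (Submodule.span_le.mpr ?_)
    rintro _ ⟨k, rfl⟩
    exact Submodule.add_mem_sup (Submodule.subset_span ⟨k, rfl⟩) (Submodule.subset_span ⟨k, rfl⟩)
  smul_mem' := by
    intro c a (ha : FiniteDimensional ℂ _)
    refine Submodule.finiteDimensional_of_le (S₂ := Submodule.span ℂ
      (Set.range fun k : D.K => fun x : D.K => a.1 (k⁻¹ * x))) (Submodule.span_le.mpr ?_)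
    rintro _ ⟨k, rfl⟩
    exact Submodule.smul_mem _ c (Submodule.subset_span ⟨k, rfl⟩)

/-- Frobenius reciprocity: an intertwining operator `L` from `ν` is determined by the linear map
`v ↦ L(v)(1)`, so isotypic subspaces are finite dimensional. -/
instance finiteDimensional_isotypicSections [FiniteDimensional ℂ Vκ] [FiniteDimensional ℂ Vγ]
    (ν : UnitaryDual D.K) : FiniteDimensional ℂ (isotypicSections (Vγ := Vγ) κ ν) := by
  let X := EuclideanSpace ℂ (Fin ν.out.1)
  let ev : D.sections Vγ κ →ₗ[ℂ] D.K → Vκ ⊗[ℂ] Vγ :=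
    { toFun := fun φ x => φ.1 x, map_add' := fun _ _ => rfl, map_smul' := fun _ _ => rfl }
  have hev : Function.Injective ev := fun φ ψ h =>
    Subtype.ext (ContinuousMap.ext fun x => congrFun h x)
  let β : (X →ₗ[ℂ] Vκ ⊗[ℂ] Vγ) →ₗ[ℂ] X →ₗ[ℂ] D.K → Vκ ⊗[ℂ] Vγ :=
    LinearMap.mk₂ ℂ (fun ℓ v x => ℓ (ν.out.2.1.op x⁻¹ v))
      (fun _ _ _ => rfl) (fun _ _ _ => rfl) (fun _ _ _ => by ext1 x; simp)
      (fun _ _ _ => by ext1 x; simp)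
  have hβ : FiniteDimensional ℂ (Submodule.map₂ β ⊤ ⊤) :=
    .of_fg (Submodule.FG.map₂ β Module.Finite.fg_top Module.Finite.fg_top)
  have hle : (isotypicSections (Vγ := Vγ) κ ν).map ev ≤ Submodule.map₂ β ⊤ ⊤ := by
    rw [isotypicSections, Submodule.map_span, Submodule.span_le]
    rintro _ ⟨φ, ⟨L, hL, v, rfl⟩, rfl⟩
    let ℓ : X →ₗ[ℂ] Vκ ⊗[ℂ] Vγ := LinearMap.proj 1 ∘ₗ ev ∘ₗ L
    have h : ev (L v) = β ℓ v := by
      ext1 x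
      change (L v).1 x = (L (ν.out.2.1.op x⁻¹ v)).1 1
      rw [hL]
      simp
    rw [h]
    exact Submodule.apply_mem_map₂ _ Submodule.mem_top Submodule.mem_top
  have := Submodule.finiteDimensional_of_le hle
  exact Module.Finite.equiv (Submodule.equivMapOfInjective ev hev _).symm

theorem translate_psiT [FiniteDimensional ℂ Vκ] [FiniteDimensional ℂ Vγ] {γ : UnitaryRep D.K Vγ}
    (T : mInvariants κ γ) (k x : D.K) :
    (translate k (psiT T)).1 x = (fiberMap (γ.op k⁻¹ : Vγ →ₗ[ℂ] Vγ) (psiT T)).1 x := by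
  change TensorProduct.map LinearMap.id (γ.op (k⁻¹ * x) : Vγ →ₗ[ℂ] Vγ) T.1 =
    TensorProduct.map LinearMap.id (γ.op k⁻¹ : Vγ →ₗ[ℂ] Vγ)
      (TensorProduct.map LinearMap.id (γ.op x : Vγ →ₗ[ℂ] Vγ) T.1)
  rw [γ.op_mul, ← LinearMap.comp_apply, ← TensorProduct.map_comp]
  rfl

/-- The section `ψ_T` lies in the finite dimensional translation invariant space of the sections
`(1 ⊗ B) ψ_T`, `B ∈ End(V_γ)`. -/
theorem exists_stable_psiT [FiniteDimensional ℂ Vκ] [FiniteDimensional ℂ Vγ]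
    {γ : UnitaryRep D.K Vγ} (T : mInvariants κ γ) :
    ∃ W : Submodule ℂ (D.sections Vγ κ), FiniteDimensional ℂ W ∧
      (∀ k, ∀ φ ∈ W, translate k φ ∈ W) ∧ psiT T ∈ W := by
  let J : (Vγ →ₗ[ℂ] Vγ) →ₗ[ℂ] D.sections Vγ κ :=
    { toFun := fun B => fiberMap B (psiT T)
      map_add' := fun B C => by
        ext x
        change TensorProduct.map LinearMap.id (B + C) _ = _
        rw [TensorProduct.map_add_right]; rfl
      map_smul' := fun c B => by
        ext x
        change TensorProduct.map LinearMap.id (c • B) _ = _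
        rw [TensorProduct.map_smul_right]; rfl }
  refine ⟨LinearMap.range J, inferInstance, ?_, LinearMap.id, ?_⟩
  · rintro k _ ⟨B, rfl⟩
    refine ⟨B ∘ₗ (γ.op k⁻¹ : Vγ →ₗ[ℂ] Vγ), ?_⟩
    ext x
    change TensorProduct.map LinearMap.id (B ∘ₗ (γ.op k⁻¹ : Vγ →ₗ[ℂ] Vγ)) ((psiT T).1 x) =
      TensorProduct.map LinearMap.id B ((translate k (psiT T)).1 x)
    rw [translate_psiT, fiberMap_apply, ← LinearMap.comp_apply, ← TensorProduct.map_comp]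
    simp
  · ext x
    change TensorProduct.map LinearMap.id LinearMap.id _ = _
    rw [TensorProduct.map_id]; rfl

end Translation

section L2

variable [IsTopologicalGroup G] [MeasurableSpace G] [BorelSpace G] [SecondCountableTopology G]
  {D : IwasawaDecomposition E G}
  {Vκ : Type*} [NormedAddCommGroup Vκ] [InnerProductSpace ℂ Vκ] [FiniteDimensional ℂ Vκ]
  {Vγ : Type*} [NormedAddCommGroup Vγ] [InnerProductSpace ℂ Vγ] [FiniteDimensional ℂ Vγ]
  {κ : UnitaryRep D.M Vκ}

instance : IsProbabilityMeasure D.haarK := ⟨by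
  rw [haarK, ← TopologicalSpace.PositiveCompacts.coe_top]; exact Measure.haarMeasure_self⟩

/-- The space of continuous sections, carrying the `L²` inner product instead of the supremum
norm. -/
def L2Sections (κ : UnitaryRep D.M Vκ) (Vγ : Type*) [NormedAddCommGroup Vγ]
    [InnerProductSpace ℂ Vγ] : Type _ := D.sections Vγ κ

namespace L2Sections

instance : AddCommGroup (L2Sections κ Vγ) := inferInstanceAs (AddCommGroup (D.sections Vγ κ))

instance : Module ℂ (L2Sections κ Vγ) := inferInstanceAs (Module ℂ (D.sections Vγ κ))

/-- The inclusion of the continuous sections into `L²`. -/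
def toL2 (κ : UnitaryRep D.M Vκ) (Vγ : Type*) [NormedAddCommGroup Vγ] [InnerProductSpace ℂ Vγ] :
    L2Sections κ Vγ →ₗ[ℂ] Lp (Vκ ⊗[ℂ] Vγ) 2 D.haarK :=
  (ContinuousMap.toLp (E := Vκ ⊗[ℂ] Vγ) 2 D.haarK ℂ).toLinearMap ∘ₗ (D.sections Vγ κ).subtype

theorem toL2_injective : Function.Injective (toL2 κ Vγ) :=
  (ContinuousMap.toLp_injective D.haarK).comp Subtype.val_injective

instance : NormedAddCommGroup (L2Sections κ Vγ) :=
  NormedAddCommGroup.induced _ _ (toL2 κ Vγ) toL2_injective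

instance : InnerProductSpace ℂ (L2Sections κ Vγ) where
  norm_smul_le c φ := by
    change ‖toL2 κ Vγ (c • φ)‖ ≤ ‖c‖ * ‖toL2 κ Vγ φ‖
    rw [map_smul, norm_smul]
  inner φ ψ := inner ℂ (toL2 κ Vγ φ) (toL2 κ Vγ ψ)
  norm_sq_eq_re_inner φ := norm_sq_eq_re_inner (𝕜 := ℂ) (toL2 κ Vγ φ)
  conj_inner_symm φ ψ := inner_conj_symm _ _
  add_left φ ψ χ := by rw [map_add, inner_add_left]
  smul_left φ ψ c := by rw [map_smul, inner_smul_left]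

theorem inner_def (φ ψ : L2Sections κ Vγ) :
    inner ℂ φ ψ = ∫ k, inner ℂ (φ.1 k) (ψ.1 k) ∂D.haarK := by
  refine integral_congr_ae ?_
  filter_upwards [ContinuousMap.coeFn_toLp (p := 2) (𝕜 := ℂ) D.haarK φ.1,
    ContinuousMap.coeFn_toLp (p := 2) (𝕜 := ℂ) D.haarK ψ.1] with k h1 h2
  exact congrArg₂ (inner ℂ) h1 h2

theorem inner_translate (k : D.K) (φ ψ : L2Sections κ Vγ) :
    inner ℂ (show L2Sections κ Vγ from translate k φ)
      (show L2Sections κ Vγ from translate k ψ) =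
      inner ℂ φ ψ := by
  rw [inner_def, inner_def]
  exact integral_mul_left_eq_self (fun x => inner ℂ (φ.1 x) (ψ.1 x)) k⁻¹

/-- The unitary representation of `K` on sections by left translations. -/
def leftRep (κ : UnitaryRep D.M Vκ) (Vγ : Type*) [NormedAddCommGroup Vγ] [InnerProductSpace ℂ Vγ]
    [FiniteDimensional ℂ Vγ] : UnitaryRep D.K (L2Sections κ Vγ) where
  toHom :=
    { toFun := fun k =>
        LinearEquiv.isometryOfInner
          { (translate k : D.sections Vγ κ →ₗ[ℂ] D.sections Vγ κ) with
            invFun := translate k⁻¹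
            left_inv := fun φ => by
              apply Subtype.ext; ext x; simp [translate]
            right_inv := fun φ => by
              apply Subtype.ext; ext x; simp [translate] }
          (inner_translate k)
      map_one' := by ext1 φ; apply Subtype.ext; ext x; change φ.1 (1⁻¹ * x) = φ.1 x; simp
      map_mul' := fun s t => by
        ext1 φ; apply Subtype.ext; ext x
        change φ.1 ((s * t)⁻¹ * x) = φ.1 (t⁻¹ * (s⁻¹ * x))
        simp [mul_assoc] }
  continuous_apply φ := by
    have h : Topology.IsInducing (toL2 κ Vγ) := ⟨rfl⟩
    rw [h.continuous_iff]
    exact (ContinuousMap.toLp 2 D.haarK ℂ).continuous.comp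
      (continuous_subtype_val.comp (continuous_translate (D := D) φ))

/-- The isotypic subspaces of the left regular representation on sections are the given ones. -/
theorem isotypic_leftRep (ν : UnitaryDual D.K) :
    (leftRep κ Vγ).isotypic ν = isotypicSections (Vγ := Vγ) κ ν := by
  refine congrArg (Submodule.span ℂ) (Set.ext fun φ => exists_congr fun L => and_congr ?_ Iff.rfl)
  exact ⟨fun h k x v => congrArg (fun χ : D.sections Vγ κ => χ.1 x) (h k v),
    fun h k v => Subtype.ext (ContinuousMap.ext fun x => h k x v)⟩

instance (ν : UnitaryDual D.K) : FiniteDimensional ℂ ((leftRep κ Vγ).isotypic ν) := by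
  rw [isotypic_leftRep]; exact finiteDimensional_isotypicSections ν

end L2Sections

/-- The `L²` pairing `ψ ↦ ∫ ⟨φ(k), ψ(k)⟩ dk` with a continuous section `φ`. -/
def l2Pairing (φ : D.sections Vγ κ) : D.sections Vγ κ →ₗ[ℂ] ℂ where
  toFun ψ := ∫ k, inner ℂ (φ.1 k) (ψ.1 k) ∂D.haarK
  map_add' ψ χ :=
    (L2Sections.inner_def (κ := κ) φ (ψ + χ)).symm.trans
      ((inner_add_right (E := L2Sections κ Vγ) φ ψ χ).trans
        (congrArg₂ (· + ·) (L2Sections.inner_def φ ψ) (L2Sections.inner_def φ χ)))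
  map_smul' c ψ :=
    (L2Sections.inner_def (κ := κ) φ (c • ψ)).symm.trans
      ((inner_smul_right (E := L2Sections κ Vγ) φ ψ c).trans
        (congrArg (c * ·) (L2Sections.inner_def φ ψ)))

theorem l2Pairing_apply (φ ψ : D.sections Vγ κ) :
    l2Pairing φ ψ = ∫ k, inner ℂ (φ.1 k) (ψ.1 k) ∂D.haarK := rfl

theorem l2Pairing_eq_inner (φ ψ : D.sections Vγ κ) :
    l2Pairing φ ψ = inner ℂ (show L2Sections κ Vγ from φ) (show L2Sections κ Vγ from ψ) :=
  (L2Sections.inner_def (κ := κ) φ ψ).symm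

theorem conj_l2Pairing (φ ψ : D.sections Vγ κ) :
    starRingEnd ℂ (l2Pairing ψ φ) = l2Pairing φ ψ := by
  rw [l2Pairing_eq_inner, l2Pairing_eq_inner, inner_conj_symm]

/-- Nondegeneracy of the `L²` pairing on a subspace; it uses that Haar measure is positive on
nonempty open sets, so that distinct continuous sections are distinct in `L²`. -/
theorem eq_of_l2Pairing_eq (W : Submodule ℂ (D.sections Vγ κ)) {u u' : D.sections Vγ κ}
    (hu : u ∈ W) (hu' : u' ∈ W) (h : ∀ φ ∈ W, l2Pairing u φ = l2Pairing u' φ) : u = u' := by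
  have h0 := h _ (W.sub_mem hu hu')
  rw [l2Pairing_eq_inner, l2Pairing_eq_inner, ← sub_eq_zero, ← inner_sub_left] at h0
  exact sub_eq_zero.mp (inner_self_eq_zero (𝕜 := ℂ) (E := L2Sections κ Vγ).mp h0)

/-- Riesz representation on an isotypic subspace, which is finite dimensional. -/
theorem exists_l2Pairing_eq (ν : UnitaryDual D.K) (F : D.sections Vγ κ →ₗ[ℂ] ℂ) :
    ∃ u ∈ isotypicSections κ ν, ∀ φ ∈ isotypicSections κ ν, l2Pairing u φ = F φ := by
  obtain ⟨u, hu, h⟩ := exists_inner_eq_on ((L2Sections.leftRep κ Vγ).isotypic ν) F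
  rw [L2Sections.isotypic_leftRep] at hu h
  exact ⟨u, hu, fun φ hφ => (l2Pairing_eq_inner u φ).trans (h φ hφ)⟩

theorem l2Pairing_eq_zero_of_ne {ν ν' : UnitaryDual D.K} (h : ν ≠ ν') {φ ψ : D.sections Vγ κ}
    (hφ : φ ∈ isotypicSections κ ν) (hψ : ψ ∈ isotypicSections κ ν') : l2Pairing φ ψ = 0 := by
  rw [← L2Sections.isotypic_leftRep] at hφ hψ
  exact (l2Pairing_eq_inner φ ψ).trans ((L2Sections.leftRep κ Vγ).inner_isotypic_eq_zero h hφ hψ)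

/-- A section in a finite dimensional translation invariant space is a finite sum of sections in
isotypic subspaces. -/
theorem exists_finsupp_isotypicSections (W : Submodule ℂ (D.sections Vγ κ))
    [hf : FiniteDimensional ℂ W] (hW : ∀ k, ∀ φ ∈ W, translate k φ ∈ W) {φ : D.sections Vγ κ}
    (hφ : φ ∈ W) : ∃ w : UnitaryDual D.K →₀ D.sections Vγ κ,
      (∀ ν, w ν ∈ isotypicSections κ ν) ∧ ∑ ν ∈ w.support, w ν = φ := by
  have h := @UnitaryRep.le_iSup_isotypic _ _ _ _ _ _ (L2Sections.leftRep κ Vγ) W hf hW φ hφ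
  simp only [L2Sections.isotypic_leftRep] at h
  exact (Submodule.mem_iSup_iff_exists_finsupp (isotypicSections (Vγ := Vγ) κ) φ).mp h

theorem l2Pairing_translate (k : D.K) (φ ψ : D.sections Vγ κ) :
    l2Pairing (translate k φ) (translate k ψ) = l2Pairing φ ψ :=
  integral_mul_left_eq_self (fun x => inner ℂ (φ.1 x) (ψ.1 x)) k⁻¹

end L2
end IwasawaDecomposition

/-! ### Components of the distribution `δ_T` and invariant functionals -/

namespace IwasawaDecomposition

variable {E : Type*} [NormedAddCommGroup E] [NormedSpace ℝ E] [CompleteSpace E]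
  {G : Type*} [TopologicalSpace G] [ChartedSpace E G] [Group G]
  [LieGroup 𝓘(ℝ, E) (minSmoothness ℝ 3) G]

section Algebra

variable [IsTopologicalGroup G] [MeasurableSpace G] [BorelSpace G] [SecondCountableTopology G]
  {D : IwasawaDecomposition E G}
  {Vκ : Type*} [NormedAddCommGroup Vκ] [InnerProductSpace ℂ Vκ] [FiniteDimensional ℂ Vκ]
  {Vγ : Type*} [NormedAddCommGroup Vγ] [InnerProductSpace ℂ Vγ] [FiniteDimensional ℂ Vγ]
  {κ : UnitaryRep D.M Vκ}

/-- The components of `δ_T` exist, since isotypic subspaces are finite dimensional. -/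
theorem isComponent_component_deltaT (T : Vκ ⊗[ℂ] Vγ) (ν : UnitaryDual D.K) :
    IsComponent (deltaT κ T) ν (component (deltaT κ T) ν) :=
  Classical.epsilon_spec (p := IsComponent (deltaT κ T) ν) <| exists_l2Pairing_eq ν
    { toFun := deltaT κ T
      map_add' := fun φ ψ => inner_add_right T (φ.1 1) (ψ.1 1)
      map_smul' := fun c φ => inner_smul_right T (φ.1 1) c }

theorem inner_map_id_op (γ : UnitaryRep D.K Vγ) (k : D.K) (s t : Vκ ⊗[ℂ] Vγ) :
    inner ℂ (TensorProduct.map LinearMap.id (γ.op k : Vγ →ₗ[ℂ] Vγ) s)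
      (TensorProduct.map LinearMap.id (γ.op k : Vγ →ₗ[ℂ] Vγ) t) = inner ℂ s t :=
  TensorProduct.inner_map_map LinearIsometry.id (γ.toHom k).toLinearIsometry s t

/-- The diagonal action `(k φ)(x) = (1 ⊗ γ(k)) φ(k⁻¹ x)` on sections. -/
def diagAct (γ : UnitaryRep D.K Vγ) (k : D.K) : D.sections Vγ κ →ₗ[ℂ] D.sections Vγ κ :=
  fiberMap (γ.op k : Vγ →ₗ[ℂ] Vγ) ∘ₗ translate k

theorem diagAct_apply (γ : UnitaryRep D.K Vγ) (k : D.K) (φ : D.sections Vγ κ) (x : D.K) :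
    (diagAct γ k φ).1 x =
      TensorProduct.map LinearMap.id (γ.op k : Vγ →ₗ[ℂ] Vγ) (φ.1 (k⁻¹ * x)) := rfl

theorem diagAct_psiT {γ : UnitaryRep D.K Vγ} (T : mInvariants κ γ) (k : D.K) :
    diagAct γ k (psiT T) = psiT T := by
  ext x
  change TensorProduct.map LinearMap.id (γ.op k : Vγ →ₗ[ℂ] Vγ)
    (TensorProduct.map LinearMap.id (γ.op (k⁻¹ * x) : Vγ →ₗ[ℂ] Vγ) T.1) =
    TensorProduct.map LinearMap.id (γ.op x : Vγ →ₗ[ℂ] Vγ) T.1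
  conv_rhs => rw [← mul_inv_cancel_left k x, γ.op_mul]
  rw [← LinearMap.comp_apply, ← TensorProduct.map_comp]
  rfl

theorem diagAct_mul_inv (γ : UnitaryRep D.K Vγ) (k : D.K) (φ : D.sections Vγ κ) :
    diagAct γ k (diagAct γ k⁻¹ φ) = φ := by
  ext x
  rw [diagAct_apply, diagAct_apply, ← LinearMap.comp_apply, ← TensorProduct.map_comp]
  have h : (γ.op k : Vγ →ₗ[ℂ] Vγ) ∘ₗ (γ.op k⁻¹ : Vγ →ₗ[ℂ] Vγ) = LinearMap.id := by
    ext v; exact γ.op_op_inv k v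
  rw [h, LinearMap.comp_id, TensorProduct.map_id]
  simp

theorem l2Pairing_diagAct (γ : UnitaryRep D.K Vγ) (k : D.K) (φ ψ : D.sections Vγ κ) :
    l2Pairing (diagAct γ k φ) (diagAct γ k ψ) = l2Pairing φ ψ := by
  rw [← l2Pairing_translate k φ ψ]
  exact integral_congr_ae (.of_forall fun x => inner_map_id_op γ k _ _)

theorem diagAct_mem_isotypicSections (γ : UnitaryRep D.K Vγ) (k : D.K) (ν : UnitaryDual D.K)
    {φ : D.sections Vγ κ} (hφ : φ ∈ isotypicSections κ ν) :
    diagAct γ k φ ∈ isotypicSections κ ν := by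
  rw [← L2Sections.isotypic_leftRep] at hφ ⊢
  exact (L2Sections.leftRep κ Vγ).map_mem_isotypic ν
    (fiberMap (D := D) (κ := κ) (γ.op k : Vγ →ₗ[ℂ] Vγ)) (fun _ _ => rfl)
    ((L2Sections.leftRep κ Vγ).isStable_isotypic ν k φ hφ)

/-- On invariant sections the distribution `δ_T` is given by the `L²` pairing with `ψ_T`. -/
theorem deltaT_eq_l2Pairing_psiT {γ : UnitaryRep D.K Vγ} (T : mInvariants κ γ)
    (u : D.sections Vγ κ) (hu : ∀ k, diagAct γ k u = u) :
    deltaT κ T.1 u = l2Pairing (psiT T) u := by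
  have h : ∀ k : D.K, inner ℂ ((psiT T).1 k) (u.1 k) = deltaT κ T.1 u := by
    intro k
    have h1 : u.1 k = TensorProduct.map LinearMap.id (γ.op k : Vγ →ₗ[ℂ] Vγ) (u.1 1) := by
      conv_lhs => rw [← hu k]
      rw [diagAct_apply, inv_mul_cancel]
    rw [h1]
    exact inner_map_id_op γ k _ _
  simp [l2Pairing_apply, h]

/-- A functional which is invariant under the diagonal action is represented on an isotypic
subspace by an invariant section. -/
theorem exists_diagAct_invariant_l2Pairing_eq (γ : UnitaryRep D.K Vγ) (ν : UnitaryDual D.K)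
    (F : D.sections Vγ κ →ₗ[ℂ] ℂ)
    (hF : ∀ φ ∈ isotypicSections (Vγ := Vγ) κ ν, ∀ k, F (diagAct γ k φ) = F φ) :
    ∃ u ∈ isotypicSections κ ν, (∀ k, diagAct γ k u = u) ∧
      ∀ φ ∈ isotypicSections κ ν, l2Pairing u φ = F φ := by
  obtain ⟨u, hu, hFu⟩ := exists_l2Pairing_eq ν F
  refine ⟨u, hu, fun k => ?_, hFu⟩
  refine eq_of_l2Pairing_eq _ (diagAct_mem_isotypicSections γ k ν hu) hu fun φ hφ => ?_
  have hφ' := diagAct_mem_isotypicSections γ k⁻¹ ν hφ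
  rw [← diagAct_mul_inv γ k φ, l2Pairing_diagAct, diagAct_mul_inv, hFu _ hφ', hF φ hφ, hFu _ hφ]

/-- For a functional `F` which is invariant under the diagonal action, `F(δ_T) = F(ψ_T)`: on an
isotypic subspace `F` is the pairing with an invariant section `u`, which cannot distinguish the
component of `δ_T` from that of `ψ_T`. -/
theorem finsum_component_deltaT {γ : UnitaryRep D.K Vγ} (T : mInvariants κ γ)
    (F : D.sections Vγ κ →ₗ[ℂ] ℂ)
    (hF : ∀ ν, ∀ φ ∈ isotypicSections (Vγ := Vγ) κ ν, ∀ k, F (diagAct γ k φ) = F φ) :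
    ∑ᶠ ν, F (component (deltaT κ T.1) ν) = F (psiT T) := by
  obtain ⟨W, hWf, hW, hT⟩ := exists_stable_psiT T
  obtain ⟨w, hw, hsum⟩ := exists_finsupp_isotypicSections W hW hT
  have key : ∀ ν, F (component (deltaT κ T.1) ν) = F (w ν) := by
    intro ν
    obtain ⟨u, hu, hinv, hFu⟩ := exists_diagAct_invariant_l2Pairing_eq γ ν F (hF ν)
    obtain ⟨hδ, hδ'⟩ := isComponent_component_deltaT (κ := κ) T.1 ν
    calc F (component (deltaT κ T.1) ν)
        = l2Pairing u (component (deltaT κ T.1) ν) := (hFu _ hδ).symm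
      _ = starRingEnd ℂ (deltaT κ T.1 u) := by rw [← conj_l2Pairing, ← hδ' u hu, l2Pairing_apply]
      _ = l2Pairing u (psiT T) := by rw [deltaT_eq_l2Pairing_psiT T u hinv, conj_l2Pairing]
      _ = l2Pairing u (w ν) := by
          rw [← hsum, map_sum]
          refine Finset.sum_eq_single ν (fun ν' _ hne => ?_) fun h => ?_
          · exact l2Pairing_eq_zero_of_ne hne.symm hu (hw ν')
          · rw [Finsupp.notMem_support_iff.mp h, map_zero]
      _ = F (w ν) := hFu _ (hw ν)
  simp only [key]
  rw [finsum_eq_sum_of_support_subset (s := w.support), ← hsum, map_sum]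
  intro ν hν
  simp only [Function.mem_support, Finset.mem_coe, Finsupp.mem_support_iff] at hν ⊢
  intro h
  exact hν (by rw [h, map_zero])

end Algebra
end IwasawaDecomposition

/-! ### Unitary embeddings and their functionals -/

namespace IwasawaDecomposition

variable {E : Type*} [NormedAddCommGroup E] [NormedSpace ℝ E] [CompleteSpace E]
  {G : Type*} [TopologicalSpace G] [ChartedSpace E G] [Group G]
  [LieGroup 𝓘(ℝ, E) (minSmoothness ℝ 3) G]

theorem isExp_zero : IsExp (0 : GroupLieAlgebra 𝓘(ℝ, E) G) (1 : G) := by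
  refine ⟨fun _ => 1, ⟨fun _ _ => (one_mul 1).symm, ?_⟩, rfl⟩
  have h : ContinuousLinearMap.toSpanSingleton ℝ (0 : E) = 0 := by ext; simp
  have h1 := hasMFDerivAt_const (I := 𝓘(ℝ, ℝ)) (I' := 𝓘(ℝ, E)) (1 : G) (0 : ℝ)
  exact (congrArg (HasMFDerivAt 𝓘(ℝ, ℝ) 𝓘(ℝ, E) (fun _ : ℝ => (1 : G)) 0) h).mpr h1

theorem kPart_logPart_coe (D : IwasawaDecomposition E G) (k : D.K) :
    D.kPart (k : G) = k ∧ D.logPart (k : G) = 0 := by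
  have h := (D.decomp (k : G)).choose_spec.2 (k, 0, 1) ⟨1, isExp_zero, by simp⟩
  exact ⟨congrArg Prod.fst h.symm, congrArg (fun q => q.2.1) h.symm⟩

theorem rho_zero (D : IwasawaDecomposition E G) : D.rho 0 = 0 := by
  have h : (LieAlgebra.ad ℝ (GroupLieAlgebra 𝓘(ℝ, E) G)
      ((0 : D.𝔞) : GroupLieAlgebra 𝓘(ℝ, E) G)).restrict
      (lie_mem_positivePart D.𝔞 D.H₀ 0) = 0 := by
    ext x
    simp
  rw [rho]
  exact (congrArg (fun A => 1 / 2 * LinearMap.trace ℝ D.𝔫 A) h).trans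
    ((congrArg (1 / 2 * ·) (map_zero (LinearMap.trace ℝ D.𝔫))).trans (mul_zero _))

/-- On `K` the principal series representation is given by left translations. -/
theorem psAction_coe_K (D : IwasawaDecomposition E G) {Vκ : Type*} [NormedAddCommGroup Vκ]
    [InnerProductSpace ℂ Vκ] (lam : Module.Dual ℝ D.𝔞) (k : D.K) (φ : D.K → Vκ) (x : D.K) :
    D.psAction lam (k : G) φ x = φ (k⁻¹ * x) := by
  have h : (k : G)⁻¹ * x = ((k⁻¹ * x : D.K) : G) := rfl
  rw [psAction, h, (D.kPart_logPart_coe _).1, (D.kPart_logPart_coe _).2, D.rho_zero]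
  simp

theorem norm_sq_eq_integral_norm_sq {α : Type*} [MeasurableSpace α] {μ : Measure α} {F : Type*}
    [NormedAddCommGroup F] [InnerProductSpace ℂ F] (f : Lp F 2 μ) :
    ‖f‖ ^ 2 = ∫ x, ‖f x‖ ^ 2 ∂μ := by
  have h : ((‖f‖ ^ 2 : ℝ) : ℂ) = ((∫ x, ‖f x‖ ^ 2 ∂μ : ℝ) : ℂ) := by
    rw [← integral_complex_ofReal]
    have h1 : (inner ℂ f f : ℂ) = (‖f‖ : ℂ) ^ 2 := inner_self_eq_norm_sq_to_K f
    rw [Complex.ofReal_pow, ← h1, L2.inner_def]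
    refine integral_congr_ae (.of_forall fun x => ?_)
    exact (inner_self_eq_norm_sq_to_K (f x)).trans (Complex.ofReal_pow _ _).symm
  exact_mod_cast h

theorem integral_comp_of_measurePreserving {α : Type*} [MeasurableSpace α] {μ : Measure α}
    {t : α → α} (ht : MeasurePreserving t μ μ) {F : α → ℂ} (hF : AEStronglyMeasurable F μ) :
    ∫ x, F (t x) ∂μ = ∫ x, F x ∂μ := by
  conv_rhs => rw [← ht.map_eq]
  exact (integral_map ht.measurable.aemeasurable (by rwa [ht.map_eq])).symm

section Contract

variable {Vκ : Type*} [NormedAddCommGroup Vκ] [InnerProductSpace ℂ Vκ] [FiniteDimensional ℂ Vκ]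
  {Vγ : Type*} [NormedAddCommGroup Vγ] [InnerProductSpace ℂ Vγ] [FiniteDimensional ℂ Vγ]
  {ι : Type*} [Fintype ι]

theorem contract_map_right (e : OrthonormalBasis ι ℂ Vγ) (v : Vγ) (B : Vγ →ₗ[ℂ] Vγ)
    (t : Vκ ⊗[ℂ] Vγ) : contract Vκ v (TensorProduct.map LinearMap.id B t) =
      ∑ i, inner ℂ v (B (e i)) • contract Vκ (e i) t := by
  induction t using TensorProduct.induction_on with
  | zero => simp
  | tmul a b =>
    simp only [TensorProduct.map_tmul, LinearMap.id_apply, contract_tmul, smul_smul]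
    conv_lhs => rw [← e.sum_repr' b]
    rw [← Finset.sum_smul]
    simp only [map_sum, map_smul, inner_sum, inner_smul_right, mul_comm]
  | add a b ha hb => simp only [map_add, ha, hb, smul_add, Finset.sum_add_distrib]

theorem sum_contract_tmul (e : OrthonormalBasis ι ℂ Vγ) (t : Vκ ⊗[ℂ] Vγ) :
    ∑ i, contract Vκ (e i) t ⊗ₜ[ℂ] e i = t := by
  induction t using TensorProduct.induction_on with
  | zero => simp
  | tmul a b =>
    simp only [contract_tmul, TensorProduct.smul_tmul]
    rw [← TensorProduct.tmul_sum, e.sum_repr']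
  | add a b ha hb => simp only [map_add, TensorProduct.add_tmul, Finset.sum_add_distrib, ha, hb]

theorem sum_norm_sq_contract (e : OrthonormalBasis ι ℂ Vγ) (t : Vκ ⊗[ℂ] Vγ) :
    ∑ i, ‖contract Vκ (e i) t‖ ^ 2 = ‖t‖ ^ 2 := by
  classical
  have h : (inner ℂ t t : ℂ) = ∑ i, (‖contract Vκ (e i) t‖ : ℂ) ^ 2 := by
    conv_lhs => rw [← sum_contract_tmul e t]
    simp only [sum_inner, inner_sum, TensorProduct.inner_tmul, e.inner_eq_ite]
    simp
  have h2 : (‖t‖ : ℂ) ^ 2 = ∑ i, (‖contract Vκ (e i) t‖ : ℂ) ^ 2 :=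
    (inner_self_eq_norm_sq_to_K t).symm.trans h
  exact_mod_cast h2.symm

end Contract

section Embedding

variable [IsTopologicalGroup G] [MeasurableSpace G] [BorelSpace G] [SecondCountableTopology G]
  {D : IwasawaDecomposition E G}
  {Vκ : Type*} [NormedAddCommGroup Vκ] [InnerProductSpace ℂ Vκ] [FiniteDimensional ℂ Vκ]
  {Vγ : Type*} [NormedAddCommGroup Vγ] [InnerProductSpace ℂ Vγ] [FiniteDimensional ℂ Vγ]
  {κ : UnitaryRep D.M Vκ} {Γ : Subgroup G} {μ : Measure (LeftQuot Γ)}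

theorem coordinate_coeFn (v : Vγ) (φ : D.sections Vγ κ) :
    ((coordinate v φ : Lp Vκ 2 D.haarK) : D.K → Vκ) =ᵐ[D.haarK]
      fun k => contract Vκ v (φ.1 k) :=
  ContinuousMap.coeFn_toLp (p := 2) (𝕜 := ℂ) D.haarK _

theorem coordinate_eq_toLp (v : Vγ) (φ : D.sections Vγ κ) :
    (coordinate v φ : Lp Vκ 2 D.haarK) = ContinuousMap.toLp 2 D.haarK ℂ
      ((⟨contract Vκ v, (contract Vκ v).continuous⟩ : C(Vκ ⊗[ℂ] Vγ, Vκ)).comp φ.1) := rfl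

theorem coordinate_add (v : Vγ) (φ ψ : D.sections Vγ κ) :
    coordinate v (φ + ψ) = coordinate v φ + coordinate v ψ := by
  apply Subtype.ext
  rw [Submodule.coe_add, coordinate_eq_toLp, coordinate_eq_toLp, coordinate_eq_toLp, ← map_add]
  exact congrArg _ (ContinuousMap.ext fun x => map_add (contract Vκ v) (φ.1 x) (ψ.1 x))

theorem coordinate_smul (v : Vγ) (c : ℂ) (φ : D.sections Vγ κ) :
    coordinate v (c • φ) = c • coordinate v φ := by
  apply Subtype.ext
  rw [Submodule.coe_smul, coordinate_eq_toLp, coordinate_eq_toLp, ← map_smul]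
  exact congrArg _ (ContinuousMap.ext fun x => map_smul (contract Vκ v) c (φ.1 x))

theorem coordinate_fiberMap {ι : Type*} [Fintype ι] (e : OrthonormalBasis ι ℂ Vγ) (v : Vγ)
    (B : Vγ →ₗ[ℂ] Vγ) (φ : D.sections Vγ κ) :
    coordinate v (fiberMap B φ) = ∑ i, inner ℂ v (B (e i)) • coordinate (e i) φ := by
  apply Subtype.ext
  rw [Submodule.coe_sum]
  simp only [Submodule.coe_smul, coordinate_eq_toLp, ← map_smul, ← map_sum]
  refine congrArg _ (ContinuousMap.ext fun x => ?_)
  rw [ContinuousMap.sum_apply]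
  exact contract_map_right e v B (φ.1 x)

theorem norm_sq_coordinate (v : Vγ) (φ : D.sections Vγ κ) :
    ‖coordinate v φ‖ ^ 2 = ∫ k, ‖contract Vκ v (φ.1 k)‖ ^ 2 ∂D.haarK := by
  refine (norm_sq_eq_integral_norm_sq (coordinate v φ : Lp Vκ 2 D.haarK)).trans ?_
  refine integral_congr_ae ?_
  filter_upwards [coordinate_coeFn v φ] with k hk
  rw [hk]

variable {lam : Module.Dual ℝ D.𝔞} (ξ : D.UnitaryEmbedding κ lam μ)

namespace UnitaryEmbedding

theorem memLp_extend (φ : D.sections Vγ κ) : MemLp (ξ.extend φ) 2 μ := by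
  refine memLp_finsetSum _ fun j _ => ?_
  exact (ContinuousLinearMap.toSpanSingleton ℂ (stdOrthonormalBasis ℂ Vγ j)).comp_memLp'
    (Lp.memLp (ξ.toIsometry (coordinate (stdOrthonormalBasis ℂ Vγ j) φ)))

theorem extend_add (φ ψ : D.sections Vγ κ) :
    ξ.extend (φ + ψ) =ᵐ[μ] fun x => ξ.extend φ x + ξ.extend ψ x := by
  have h := eventually_all.mpr fun j => Lp.coeFn_add
    (ξ.toIsometry (coordinate (stdOrthonormalBasis ℂ Vγ j) φ))
    (ξ.toIsometry (coordinate (stdOrthonormalBasis ℂ Vγ j) ψ))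
  filter_upwards [h] with x hx
  simp only [extend, coordinate_add, map_add, hx, Pi.add_apply, add_smul, Finset.sum_add_distrib]

theorem extend_smul (c : ℂ) (φ : D.sections Vγ κ) :
    ξ.extend (c • φ) =ᵐ[μ] fun x => c • ξ.extend φ x := by
  have h := eventually_all.mpr fun j => Lp.coeFn_smul c
    (ξ.toIsometry (coordinate (stdOrthonormalBasis ℂ Vγ j) φ))
  filter_upwards [h] with x hx
  simp only [extend, coordinate_smul, map_smul, hx, Pi.smul_apply, smul_assoc, Finset.smul_sum]

theorem extend_fiberMap (B : Vγ →ₗ[ℂ] Vγ) (φ : D.sections Vγ κ) :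
    ξ.extend (fiberMap B φ) =ᵐ[μ] fun x => B (ξ.extend φ x) := by
  let e := stdOrthonormalBasis ℂ Vγ
  have h : ∀ j, (ξ.toIsometry (coordinate (e j) (fiberMap B φ)) : LeftQuot Γ → ℂ) =ᵐ[μ]
      fun x => ∑ i, inner ℂ (e j) (B (e i)) • ξ.toIsometry (coordinate (e i) φ) x := by
    intro j
    rw [coordinate_fiberMap e, map_sum]
    have h1 := eventually_all.mpr fun i => Lp.coeFn_smul (inner ℂ (e j) (B (e i)))
      (ξ.toIsometry (coordinate (e i) φ))
    filter_upwards [h1, Lp.coeFn_finsetSum Finset.univ fun i => ξ.toIsometry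
      (inner ℂ (e j) (B (e i)) • coordinate (e i) φ)] with x hx1 hx2
    rw [hx2, Finset.sum_apply]
    refine Finset.sum_congr rfl fun i _ => ?_
    rw [map_smul, hx1, Pi.smul_apply]
  filter_upwards [eventually_all.mpr h] with x hx
  simp only [extend, map_sum, map_smul]
  change ∑ j, ξ.toIsometry (coordinate (e j) (fiberMap B φ)) x • e j = _
  simp only [hx, Finset.sum_smul]
  rw [Finset.sum_comm]
  refine Finset.sum_congr rfl fun i _ => ?_
  change _ = ξ.toIsometry (coordinate (e i) φ) x • B (e i)
  conv_rhs => rw [← e.sum_repr' (B (e i)), Finset.smul_sum]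
  refine Finset.sum_congr rfl fun j _ => ?_
  rw [smul_smul, smul_eq_mul, mul_comm]

theorem extend_translate (k : D.K) (φ : D.sections Vγ κ) :
    ξ.extend (translate k φ) =ᵐ[μ] fun x => ξ.extend φ (LeftQuot.rmul (k : G) x) := by
  refine (eventually_all.mpr fun j => ξ.equivariant (k : G)
    (coordinate (stdOrthonormalBasis ℂ Vγ j) φ)
    (coordinate (stdOrthonormalBasis ℂ Vγ j) (translate k φ)) ?_).mono fun x hx => ?_
  · have h := (measurePreserving_mul_left D.haarK k⁻¹).quasiMeasurePreserving.ae
      (coordinate_coeFn (stdOrthonormalBasis ℂ Vγ j) φ)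
    filter_upwards [coordinate_coeFn (stdOrthonormalBasis ℂ Vγ j) (translate k φ), h]
      with x h1 h2
    rw [h1, psAction_coe_K, h2, translate_apply]
  · exact Finset.sum_congr rfl fun j _ => by rw [hx j]

/-- The map `ξ ⊗ 1` intertwines the diagonal action on sections with the action
`(k u)(x) = γ(k) u(x k)` of `K` on `V_γ`-valued functions on `Γ \ G`. -/
theorem extend_diagAct (γ : UnitaryRep D.K Vγ) (k : D.K) (φ : D.sections Vγ κ) :
    ξ.extend (diagAct γ k φ) =ᵐ[μ] fun x => γ.op k (ξ.extend φ (LeftQuot.rmul (k : G) x)) := by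
  filter_upwards [ξ.extend_fiberMap (γ.op k : Vγ →ₗ[ℂ] Vγ) (translate k φ),
    ξ.extend_translate k φ] with x h1 h2
  exact h1.trans (congrArg (γ.op k) h2)

/-- The map `ξ ⊗ 1` is isometric. -/
theorem integral_norm_sq_extend (φ : D.sections Vγ κ) :
    ∫ x, ‖ξ.extend φ x‖ ^ 2 ∂μ = ∫ k, ‖φ.1 k‖ ^ 2 ∂D.haarK := by
  let e := stdOrthonormalBasis ℂ Vγ
  have h1 : ∀ x, ‖ξ.extend φ x‖ ^ 2 = ∑ j, ‖ξ.toIsometry (coordinate (e j) φ) x‖ ^ 2 := by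
    intro x
    rw [← e.sum_sq_norm_inner_right]
    refine Finset.sum_congr rfl fun j _ => ?_
    rw [extend, e.orthonormal.inner_right_fintype]
  simp only [h1, ← sum_norm_sq_contract e]
  rw [integral_finsetSum, integral_finsetSum]
  · refine Finset.sum_congr rfl fun j _ => ?_
    rw [← norm_sq_coordinate, ← ξ.toIsometry.norm_map, norm_sq_eq_integral_norm_sq]
  · intro j _
    refine Continuous.integrable_of_hasCompactSupport ?_ (HasCompactSupport.of_compactSpace _)
    have := (contract Vκ (e j)).continuous.comp φ.1.continuous
    exact this.norm.pow 2
  · exact fun j _ => (Lp.memLp _).integrable_norm_pow (by norm_num)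

end UnitaryEmbedding

variable [CompactSpace (LeftQuot Γ)]

theorem integrable_inner_symbol {u v : LeftQuot Γ → Vγ} (hu : MemLp u 2 μ) (hv : MemLp v 2 μ)
    (f : SymbolAlgebra Γ Vγ) : Integrable (fun x => inner ℂ (u x) (f x (v x))) μ := by
  have hf : AEStronglyMeasurable (fun x => f x (v x)) μ :=
    ContinuousLinearMap.aestronglyMeasurable_comp₂ (ContinuousLinearMap.id ℂ (Vγ →L[ℂ] Vγ))
      f.continuous.measurable.stronglyMeasurable.aestronglyMeasurable hv.1
  have hfv : MemLp (fun x => f x (v x)) 2 μ := by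
    refine hv.of_le_mul (c := ‖f‖) hf (.of_forall fun x => ?_)
    exact ((f x).le_opNorm _).trans (by gcongr; exact f.norm_coe_le_norm x)
  refine (L2.integrable_inner (𝕜 := ℂ) hu.toLp hfv.toLp).congr ?_
  filter_upwards [hu.coeFn_toLp, hfv.coeFn_toLp] with x h1 h2
  rw [h1, h2]

theorem matrixFunctional_apply (u v : LeftQuot Γ → Vγ) (f : SymbolAlgebra Γ Vγ) :
    matrixFunctional μ u v f = ∫ x, inner ℂ (u x) (f x (v x)) ∂μ := rfl

namespace UnitaryEmbedding

theorem integrable_sigma (φ ψ : D.sections Vγ κ) (f : SymbolAlgebra Γ Vγ) :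
    Integrable (fun x => inner ℂ (ξ.extend φ x) (f x (ξ.extend ψ x))) μ :=
  integrable_inner_symbol (ξ.memLp_extend φ) (ξ.memLp_extend ψ) f

theorem sigma_add (φ ψ χ : D.sections Vγ κ) (f : SymbolAlgebra Γ Vγ) :
    ξ.sigma φ (ψ + χ) f = ξ.sigma φ ψ f + ξ.sigma φ χ f := by
  simp only [sigma, matrixFunctional_apply]
  rw [← integral_add (ξ.integrable_sigma φ ψ f) (ξ.integrable_sigma φ χ f)]
  refine integral_congr_ae ?_
  filter_upwards [ξ.extend_add ψ χ] with x hx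
  rw [hx, map_add, inner_add_right]

theorem sigma_smul (c : ℂ) (φ ψ : D.sections Vγ κ) (f : SymbolAlgebra Γ Vγ) :
    ξ.sigma φ (c • ψ) f = c * ξ.sigma φ ψ f := by
  simp only [sigma, matrixFunctional_apply]
  rw [← integral_const_mul]
  refine integral_congr_ae ?_
  filter_upwards [ξ.extend_smul c ψ] with x hx
  rw [hx, map_smul, inner_smul_right]

/-- For `K`-invariant `f`, the form `(φ, ψ) ↦ σ_{φ,ψ}(f)` is invariant under the diagonal action. -/
theorem sigma_diagAct (hμ : ∀ g : G, MeasurePreserving (LeftQuot.rmul g) μ μ)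
    (γ : UnitaryRep D.K Vγ) (k : D.K) (φ ψ : D.sections Vγ κ) {f : SymbolAlgebra Γ Vγ}
    (hf : f ∈ invariantSubalgebra Γ γ) :
    ξ.sigma (diagAct γ k φ) (diagAct γ k ψ) f = ξ.sigma φ ψ f := by
  have hint := ξ.integrable_sigma φ ψ f
  simp only [sigma, matrixFunctional_apply]
  rw [← integral_comp_of_measurePreserving (hμ (k : G)) hint.aestronglyMeasurable]
  refine integral_congr_ae ?_
  filter_upwards [ξ.extend_diagAct γ k φ, ξ.extend_diagAct γ k ψ] with x h1 h2
  have hfx : f x = γ.op k * f (LeftQuot.rmul (k : G) x) * γ.op k⁻¹ :=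
    (DFunLike.congr_fun (hf k) x).symm
  rw [h1, h2, hfx]
  simp only [mul_apply_eq_comp, γ.op_inv_op, γ.inner_op_op]

/-- The functional `σ_u` of a vector `u = ξ(φ)` of norm one is a state. -/
theorem isStateOn_vectorFunctional (φ : D.sections Vγ κ)
    (hφ : ∫ k, ‖φ.1 k‖ ^ 2 ∂D.haarK = 1) (B : Subalgebra ℂ (SymbolAlgebra Γ Vγ)) :
    IsStateOn B (vectorFunctional μ (ξ.extend φ)) where
  map_add f _ g _ := by
    simp only [vectorFunctional, matrixFunctional_apply]
    rw [← integral_add (ξ.integrable_sigma φ φ f) (ξ.integrable_sigma φ φ g)]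
    refine integral_congr_ae (.of_forall fun x => ?_)
    exact inner_add_right (ξ.extend φ x) (f x (ξ.extend φ x)) (g x (ξ.extend φ x))
  map_smul c f _ := by
    simp only [vectorFunctional, matrixFunctional_apply]
    rw [← integral_const_mul]
    refine integral_congr_ae (.of_forall fun x => ?_)
    exact inner_smul_right (ξ.extend φ x) (f x (ξ.extend φ x)) c
  nonneg f _ hf := by
    have h : vectorFunctional μ (ξ.extend φ) f =
        ((∫ x, (f x).reApplyInnerSelf (ξ.extend φ x) ∂μ : ℝ) : ℂ) := by
      rw [← integral_complex_ofReal]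
      refine integral_congr_ae (.of_forall fun x => ?_)
      have h1 : inner ℂ (f x (ξ.extend φ x)) (ξ.extend φ x) =
        inner ℂ (ξ.extend φ x) (f x (ξ.extend φ x)) := (hf x).1 (ξ.extend φ x) (ξ.extend φ x)
      exact h1.symm.trans ((hf x).isSymmetric.coe_reApplyInnerSelf_apply (ξ.extend φ x)).symm
    rw [h]
    exact ⟨integral_nonneg fun x => (hf x).re_inner_nonneg_left _, Complex.ofReal_im _⟩
  map_one := by
    have h : vectorFunctional μ (ξ.extend φ) 1 = ((∫ x, ‖ξ.extend φ x‖ ^ 2 ∂μ : ℝ) : ℂ) := by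
      rw [← integral_complex_ofReal]
      refine integral_congr_ae (.of_forall fun x => ?_)
      exact (inner_self_eq_norm_sq_to_K (ξ.extend φ x)).trans (Complex.ofReal_pow _ _).symm
    rw [h, ξ.integral_norm_sq_extend, hφ, Complex.ofReal_one]

end UnitaryEmbedding

/-! ### The weak limits -/

theorem integral_norm_sq_psiT {γ : UnitaryRep D.K Vγ} (T : mInvariants κ γ)
    (hT : ‖(T : Vκ ⊗[ℂ] Vγ)‖ = 1) : ∫ k, ‖(psiT T).1 k‖ ^ 2 ∂D.haarK = 1 := by
  have h : ∀ k, ‖(psiT T).1 k‖ = 1 := fun k =>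
    (TensorProduct.norm_map LinearIsometry.id (γ.toHom k).toLinearIsometry T.1).trans hT
  simp [h]

theorem isKFiniteSection_psiT {γ : UnitaryRep D.K Vγ} (T : mInvariants κ γ) :
    IsKFiniteSection (psiT T) := by
  obtain ⟨W, _, hW, hT⟩ := exists_stable_psiT T
  exact isKFiniteSection_of_mem W hW hT

theorem isKFiniteSection_of_mem_isotypicSections {ν : UnitaryDual D.K} {φ : D.sections Vγ κ}
    (hφ : φ ∈ isotypicSections κ ν) : IsKFiniteSection φ := by
  refine isKFiniteSection_of_mem _ (fun k φ hφ => ?_) hφ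
  rw [← L2Sections.isotypic_leftRep] at hφ ⊢
  exact (L2Sections.leftRep κ Vγ).isStable_isotypic ν k φ hφ

theorem ConvenientlyArranged.tendsto_limitSigma {l : Module.Dual ℝ D.𝔞}
    {lam : ℕ → Module.Dual ℝ D.𝔞} {ξ : ∀ n, D.UnitaryEmbedding κ (lam n) μ}
    (hξ : ConvenientlyArranged Vγ l ξ) {φ ψ : D.sections Vγ κ} (hφ : IsKFiniteSection φ)
    (hψ : IsKFiniteSection ψ) (f : SymbolAlgebra Γ Vγ) :
    Tendsto (fun n => (ξ n).sigma φ ψ f) atTop (𝓝 (limitSigma ξ φ ψ f)) :=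
  tendsto_nhds_limUnder (hξ.converges φ ψ hφ hψ f)

/-- Where `limitSigma` is given by a convergent sequence, it is linear in the second section. -/
theorem ConvenientlyArranged.exists_linearMap_limitSigma {l : Module.Dual ℝ D.𝔞}
    {lam : ℕ → Module.Dual ℝ D.𝔞} {ξ : ∀ n, D.UnitaryEmbedding κ (lam n) μ}
    (hξ : ConvenientlyArranged Vγ l ξ) {φ : D.sections Vγ κ} (hφ : IsKFiniteSection φ)
    (f : SymbolAlgebra Γ Vγ) : ∃ F : D.sections Vγ κ →ₗ[ℂ] ℂ,
      ∀ ψ, IsKFiniteSection ψ → F ψ = limitSigma ξ φ ψ f := by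
  let F₀ : kFiniteSections κ Vγ →ₗ[ℂ] ℂ :=
    { toFun := fun ψ => limitSigma ξ φ ψ.1 f
      map_add' := fun ψ χ => by
        refine tendsto_nhds_unique (hξ.tendsto_limitSigma hφ (ψ + χ).2 f) ?_
        simp only [Submodule.coe_add, UnitaryEmbedding.sigma_add]
        exact (hξ.tendsto_limitSigma hφ ψ.2 f).add (hξ.tendsto_limitSigma hφ χ.2 f)
      map_smul' := fun c ψ => by
        refine tendsto_nhds_unique (hξ.tendsto_limitSigma hφ (c • ψ).2 f) ?_
        simp only [Submodule.coe_smul, UnitaryEmbedding.sigma_smul]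
        exact (hξ.tendsto_limitSigma hφ ψ.2 f).const_mul c }
  -- The extension beyond the `K`-finite sections is arbitrary.
  obtain ⟨F, hF⟩ := F₀.exists_extend
  exact ⟨F, fun ψ hψ => LinearMap.congr_fun hF ⟨ψ, hψ⟩⟩

/-- For `K`-invariant `f`, the limit functional `σ_{ψ_T,δ_T}` agrees with `σ_{ψ_T,ψ_T}`. -/
theorem ConvenientlyArranged.distributionSigma_deltaT
    (hμ : ∀ g : G, MeasurePreserving (LeftQuot.rmul g) μ μ) {γ : UnitaryRep D.K Vγ}
    (T : mInvariants κ γ) {l : Module.Dual ℝ D.𝔞}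
    {lam : ℕ → Module.Dual ℝ D.𝔞} {ξ : ∀ n, D.UnitaryEmbedding κ (lam n) μ}
    (hξ : ConvenientlyArranged Vγ l ξ) {f : SymbolAlgebra Γ Vγ}
    (hf : f ∈ invariantSubalgebra Γ γ) :
    distributionSigma ξ (psiT T) (deltaT κ T.1) f = limitSigma ξ (psiT T) (psiT T) f := by
  obtain ⟨F, hF⟩ := hξ.exists_linearMap_limitSigma (isKFiniteSection_psiT T) f
  rw [← hF _ (isKFiniteSection_psiT T), ← finsum_component_deltaT T F, distributionSigma]
  · exact finsum_congr fun ν => (hF _ (isKFiniteSection_of_mem_isotypicSections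
      (isComponent_component_deltaT T.1 ν).1)).symm
  · intro ν φ hφ k
    rw [hF _ (isKFiniteSection_of_mem_isotypicSections hφ),
      hF _ (isKFiniteSection_of_mem_isotypicSections (diagAct_mem_isotypicSections γ k ν hφ))]
    refine congrArg (limUnder atTop) (funext fun n => ?_)
    rw [← (ξ n).sigma_diagAct hμ γ k (psiT T) φ hf, diagAct_psiT]

/-- A `K`-invariant element of `A_γ` is `K`-finite. -/
theorem isKFiniteSymbol_of_mem_invariantSubalgebra {γ : UnitaryRep D.K Vγ}
    {f : SymbolAlgebra Γ Vγ} (hf : f ∈ invariantSubalgebra Γ γ) : IsKFiniteSymbol γ f := by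
  have h : (Set.range fun k : D.K => kAct γ k f) = {f} := by
    simp only [show ∀ k, kAct γ k f = f from hf, Set.range_const]
  rw [IsKFiniteSymbol, h]
  infer_instance

end Embedding
end IwasawaDecomposition

end

theorem mainTheorem8 {E : Type*} [NormedAddCommGroup E] [NormedSpace ℝ E] [CompleteSpace E]
    [FiniteDimensional ℝ E] {G : Type*} [TopologicalSpace G] [ChartedSpace E G] [Group G]
    [LieGroup 𝓘(ℝ, E) (minSmoothness ℝ 3) G] [IsTopologicalGroup G] [T2Space G]
    [SecondCountableTopology G] [MeasurableSpace G] [BorelSpace G]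
    [LieAlgebra.IsSemisimple ℝ (GroupLieAlgebra 𝓘(ℝ, E) G)]
    (D : IwasawaDecomposition E G)
    (Γ : Subgroup G) [DiscreteTopology Γ] [CompactSpace (LeftQuot Γ)]
    (hΓ : ∀ g ∈ Γ, IsOfFinOrder g → g = 1)
    (μ : Measure (LeftQuot Γ)) [IsFiniteMeasure μ] (hμ0 : μ ≠ 0)
    (hμ : ∀ g : G, MeasurePreserving (LeftQuot.rmul g) μ μ)
    {Vκ : Type*} [NormedAddCommGroup Vκ] [InnerProductSpace ℂ Vκ] [FiniteDimensional ℂ Vκ]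
    {Vγ : Type*} [NormedAddCommGroup Vγ] [InnerProductSpace ℂ Vγ] [FiniteDimensional ℂ Vγ]
    (κ : UnitaryRep D.M Vκ) (hκ : κ.IsIrreducible) (γ : UnitaryRep D.K Vγ)
    (T : IwasawaDecomposition.mInvariants κ γ) (hT : ‖(T : Vκ ⊗[ℂ] Vγ)‖ = 1)
    (l : Module.Dual ℝ D.𝔞) (hl : l ∈ D.limitRays κ μ) (hlreg : D.IsRegular l)
    (lam : ℕ → Module.Dual ℝ D.𝔞) (ξ : ∀ n, D.UnitaryEmbedding κ (lam n) μ)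
    (hξ : IwasawaDecomposition.ConvenientlyArranged Vγ l ξ) :
    (∀ n, IsStateOn (invariantSubalgebra Γ γ)
      (vectorFunctional μ ((ξ n).extend (IwasawaDecomposition.psiT T)))) ∧
    (∀ f ∈ invariantSubalgebra Γ γ,
      Tendsto (fun n => vectorFunctional μ ((ξ n).extend (IwasawaDecomposition.psiT T)) f) atTop
        (𝓝 (IwasawaDecomposition.distributionSigma ξ (IwasawaDecomposition.psiT T)
          (IwasawaDecomposition.deltaT κ (T : Vκ ⊗[ℂ] Vγ)) f))) ∧
    ∀ σ : SymbolAlgebra Γ Vγ →L[ℂ] ℂ, IwasawaDecomposition.IsRepresentationTheoreticLift ξ T σ →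
      ∀ f ∈ invariantSubalgebra Γ γ,
        Tendsto (fun n => vectorFunctional μ ((ξ n).extend (IwasawaDecomposition.psiT T)) f) atTop
          (𝓝 (σ f)) := by
  have hlim : ∀ f ∈ invariantSubalgebra Γ γ,
      Tendsto (fun n => vectorFunctional μ ((ξ n).extend (IwasawaDecomposition.psiT T)) f) atTop
        (𝓝 (IwasawaDecomposition.distributionSigma ξ (IwasawaDecomposition.psiT T)
          (IwasawaDecomposition.deltaT κ (T : Vκ ⊗[ℂ] Vγ)) f)) := by
    intro f hf
    rw [hξ.distributionSigma_deltaT hμ T hf]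
    -- `σ_{ξ_n(ψ_T)}` is by definition the functional `σ^{ξ_n}_{ψ_T,ψ_T}`.
    exact hξ.tendsto_limitSigma (IwasawaDecomposition.isKFiniteSection_psiT T)
      (IwasawaDecomposition.isKFiniteSection_psiT T) f
  refine ⟨fun n => (ξ n).isStateOn_vectorFunctional _
    (IwasawaDecomposition.integral_norm_sq_psiT T hT) _, hlim, fun σ hσ f hf => ?_⟩
  rw [hσ.2 f (IwasawaDecomposition.isKFiniteSymbol_of_mem_invariantSubalgebra hf)]
  exact hlim f hf
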